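/- Let $\Bbbk$ be an algebraically closed field, and let $Q$ and $Q'$ be finite acyclic quivers (finitely many vertices and arrows, no oriented cycles). Let $\mathrm{Repr}(Q)$ be the abelian category of finite-dimensional representations of $Q$ over $\Bbbk$, with the vertex-wise tensor product $(M\otimes N)_i=M_i\otimes_{\Bbbk}N_i$, $(M\otimes N)_\alpha=M_\alpha\otimes_{\Bbbk}N_\alpha$ for vertices $i$ and arrows $\alpha$. This tensor product is exact in each variable, so its extension to bounded complexes (total complex of the tensor product) induces a monoidal structure on the bounded derived category $D^b(\mathrm{Repr}(Q))$; likewise for $Q'$. Suppose that $D^b(\mathrm{Repr}(Q))$ and $D^b(\mathrm{Repr}(Q'))$ are equivalent as monoidal triangulated categories, that is, there is an equivalence of categories $F\colon D^b(\mathrm{Repr}(Q))\to D^b(\mathrm{Repr}(Q'))$ that is $\Bbbk$-linear, strong monoidal, and triangulated (it comes with isomorphisms commuting it with the shifts, and it sends distinguished triangles to distinguished triangles). Then $Q$ and $Q'$ are isomorphic: there are a bijection $e$ from the vertices of $Q$ to those of $Q'$ and, for all vertices $a,b$ of $Q$, a bijection from the arrows $a\to b$ of $Q$ to the arrows $e(a)\to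 e(b)$ of $Q'$. -/

import Mathlib

open CategoryTheory Limits MonoidalCategory

noncomputable section

namespace QuiverDb

section Coproducts

variable {C : Type*} [Category* C] {J : Type*} {f : J → C} {s : Set J}

/-- A cofan whose restriction to `s` is a coproduct is a coproduct, if the other summands
are zero. -/
def isColimitOfRestrict (hs : ∀ j ∉ s, IsZero (f j)) (c : Cofan f)
    (hc : IsColimit (Cofan.mk c.pt (fun j : s ↦ c.inj j.1))) : IsColimit c :=
  Cofan.IsColimit.mk c (fun t ↦ hc.desc (Cofan.mk t.pt (fun j : s ↦ t.inj j.1)))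
    (fun t j ↦ by
      by_cases hj : j ∈ s
      · exact hc.fac (Cofan.mk t.pt (fun j : s ↦ t.inj j.1)) ⟨⟨j, hj⟩⟩
      · exact (hs j hj).eq_of_src _ _)
    (fun t m hm ↦ hc.hom_ext (by
      rintro ⟨⟨j, hj⟩⟩
      rw [hc.fac]
      exact hm j))

/-- The restriction of a coproduct to `s` is a coproduct, if the other summands are zero. -/
def isColimitRestrict (hs : ∀ j ∉ s, IsZero (f j)) (c : Cofan f) (hc : IsColimit c) :
    IsColimit (Cofan.mk c.pt (fun j : s ↦ c.inj j.1)) := by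
  classical
  let ext (t : Cofan (fun j : s ↦ f j.1)) : Cofan f :=
    Cofan.mk t.pt (fun j ↦ if hj : j ∈ s then t.inj ⟨j, hj⟩ else (hs j hj).to_ t.pt)
  refine Cofan.IsColimit.mk _ (fun t ↦ hc.desc (ext t)) (fun t j ↦ ?_) (fun t m hm ↦ ?_)
  · refine (hc.fac (ext t) ⟨j.1⟩).trans ?_
    simp [ext]
  · refine hc.hom_ext ?_
    rintro ⟨j⟩
    rw [hc.fac]
    by_cases hj : j ∈ s
    · refine (hm ⟨j, hj⟩).trans ?_
      simp [ext, hj]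
    · exact (hs j hj).eq_of_src _ _

lemma hasCoproduct_of_finite [HasFiniteCoproducts C] (fin : s.Finite)
    (hs : ∀ j ∉ s, IsZero (f j)) [HasZeroObject C] : HasCoproduct f := by
  classical
  have := fin.to_subtype
  let c := colimit.cocone (Discrete.functor (fun j : s ↦ f j.1))
  let c' : Cofan f := Cofan.mk c.pt (fun j ↦ if hj : j ∈ s
    then Sigma.ι (fun j : s ↦ f j.1) ⟨j, hj⟩ else (hs j hj).to_ c.pt)
  refine ⟨⟨c', isColimitOfRestrict hs c' ?_⟩⟩
  refine IsColimit.ofIsoColimit (coproductIsCoproduct (fun j : s ↦ f j.1))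
    (Cofan.ext (Iso.refl _) (fun j ↦ ?_))
  simp [c', c]

lemma preservesColimit_of_finite {D : Type*} [Category* D] [Preadditive C] [Preadditive D]
    [HasZeroObject C] [HasFiniteCoproducts C] (F : C ⥤ D) [F.Additive]
    (fin : s.Finite) (hs : ∀ j ∉ s, IsZero (f j)) :
    PreservesColimit (Discrete.functor f) F := by
  have := fin.to_subtype
  have := hasCoproduct_of_finite fin hs
  have h := isColimitRestrict hs _ (coproductIsCoproduct f)
  refine preservesColimit_of_preserves_colimit_cocone (coproductIsCoproduct f) ?_
  refine (isColimitMapCoconeCofanMkEquiv F _ _).symm ?_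
  refine isColimitOfRestrict (s := s) (fun j hj ↦ F.map_isZero (hs j hj)) _ ?_
  have : PreservesColimit (Discrete.functor (fun j : s ↦ f j.1)) F := inferInstance
  exact isColimitCofanMkObjOfIsColimit F _ _ h

end Coproducts

section Graded

variable {C : Type*} [Category* C]

/-- The graded objects with only finitely many nonzero components. -/
class FinSupp (X : GradedObject ℤ C) : Prop where
  out : ∃ s : Set ℤ, s.Finite ∧ ∀ i ∉ s, IsZero (X i)

variable [MonoidalCategory C] [Preadditive C] [MonoidalPreadditive C]

lemma isZero_tensor_left {X : C} (hX : IsZero X) (Y : C) : IsZero (X ⊗ Y) :=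
  (tensorRight Y).map_isZero hX

lemma isZero_tensor_right {Y : C} (hY : IsZero Y) (X : C) : IsZero (X ⊗ Y) :=
  (tensorLeft X).map_isZero hY

lemma exists_finite_pair (X Y : GradedObject ℤ C) [hX : FinSupp X] [hY : FinSupp Y] :
    ∃ s : Set (ℤ × ℤ), s.Finite ∧ ∀ i ∉ s, IsZero (X i.1 ⊗ Y i.2) := by
  obtain ⟨s, hs, hs'⟩ := hX.out
  obtain ⟨t, ht, ht'⟩ := hY.out
  refine ⟨s ×ˢ t, hs.prod ht, fun i hi ↦ ?_⟩
  by_cases h : i.1 ∈ s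
  · exact isZero_tensor_right (ht' _ (fun h' ↦ hi ⟨h, h'⟩)) _
  · exact isZero_tensor_left (hs' _ h) _

lemma exists_finite_triple (X Y Z : GradedObject ℤ C) [FinSupp X] [FinSupp Y] [hZ : FinSupp Z] :
    ∃ s : Set (ℤ × ℤ × ℤ), s.Finite ∧ ∀ i ∉ s, IsZero (X i.1 ⊗ (Y i.2.1 ⊗ Z i.2.2)) := by
  obtain ⟨s, hs, hs'⟩ := exists_finite_pair X Y
  obtain ⟨t, ht, ht'⟩ := hZ.out
  refine ⟨(fun p : (ℤ × ℤ) × ℤ ↦ (p.1.1, p.1.2, p.2)) '' (s ×ˢ t), (hs.prod ht).image _,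
    fun i hi ↦ ?_⟩
  by_cases h : i.2.2 ∈ t
  · refine IsZero.of_iso (isZero_tensor_left (hs' (i.1, i.2.1) (fun h' ↦ hi ?_)) (Z i.2.2))
      (α_ _ _ _).symm
    exact ⟨((i.1, i.2.1), i.2.2), ⟨h', h⟩, rfl⟩
  · exact isZero_tensor_right (isZero_tensor_right (ht' _ h) _) _

variable [HasZeroObject C] [HasFiniteCoproducts C]

open GradedObject

instance (X Y : GradedObject ℤ C) [FinSupp X] [FinSupp Y] : HasTensor X Y := by
  intro n
  obtain ⟨s, hs, hs'⟩ := exists_finite_pair X Y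
  exact hasCoproduct_of_finite (s := Subtype.val ⁻¹' s)
    (hs.preimage Subtype.val_injective.injOn) (fun i hi ↦ hs' i.1 hi)

instance (X Y Z : GradedObject ℤ C) [FinSupp X] [FinSupp Y] : HasGoodTensor₁₂Tensor X Y Z := by
  intro n i
  obtain ⟨s, hs, hs'⟩ := exists_finite_pair X Y
  exact preservesColimit_of_finite (s := Subtype.val ⁻¹' s) _
    (hs.preimage Subtype.val_injective.injOn) (fun i hi ↦ hs' i.1 hi)

instance (X Y Z : GradedObject ℤ C) [FinSupp Y] [FinSupp Z] : HasGoodTensorTensor₂₃ X Y Z := by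
  intro n i
  obtain ⟨s, hs, hs'⟩ := exists_finite_pair Y Z
  exact preservesColimit_of_finite (s := Subtype.val ⁻¹' s) _
    (hs.preimage Subtype.val_injective.injOn) (fun i hi ↦ hs' i.1 hi)

instance (X₁ X Y Z : GradedObject ℤ C) [FinSupp X] [FinSupp Y] [FinSupp Z] :
    HasTensor₄ObjExt X₁ X Y Z := by
  intro n i
  obtain ⟨s, hs, hs'⟩ := exists_finite_triple X Y Z
  exact preservesColimit_of_finite (s := Subtype.val ⁻¹' s) _
    (hs.preimage Subtype.val_injective.injOn) (fun i hi ↦ hs' i.1 hi)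

instance (X Y : GradedObject ℤ C) [FinSupp X] [FinSupp Y] :
    FinSupp (Monoidal.tensorObj X Y) := by
  obtain ⟨s, hs, hs'⟩ := exists_finite_pair X Y
  refine ⟨(fun p : ℤ × ℤ ↦ p.1 + p.2) '' s, hs.image _, fun n hn ↦ ?_⟩
  rw [IsZero.iff_id_eq_zero]
  ext i j h
  exact (hs' (i, j) (fun h' ↦ hn ⟨_, h', h⟩)).eq_of_src _ _

instance finSupp_tensorUnit : FinSupp (Monoidal.tensorUnit : GradedObject ℤ C) := by
  refine ⟨{0}, Set.finite_singleton _, fun n hn ↦ ?_⟩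
  exact (IsZero.iff_id_eq_zero _).2 ((Monoidal.isInitialTensorUnitApply n hn).hom_ext _ _)

variable (C) in
/-- The category of graded objects with only finitely many nonzero components. -/
abbrev FinGraded := ObjectProperty.FullSubcategory (fun X : GradedObject ℤ C ↦ FinSupp X)

instance (X : FinGraded C) : FinSupp X.obj := X.property

instance : MonoidalCategoryStruct (FinGraded C) where
  tensorObj X Y := ⟨Monoidal.tensorObj X.obj Y.obj, inferInstance⟩
  tensorHom f g := ⟨Monoidal.tensorHom f.hom g.hom⟩
  whiskerLeft X _ _ g := ⟨Monoidal.whiskerLeft X.obj g.hom⟩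
  whiskerRight f Y := ⟨Monoidal.whiskerRight f.hom Y.obj⟩
  tensorUnit := ⟨Monoidal.tensorUnit, inferInstance⟩
  associator X Y Z := ObjectProperty.isoMk _ (Monoidal.associator X.obj Y.obj Z.obj)
  leftUnitor X := ObjectProperty.isoMk _ (Monoidal.leftUnitor X.obj)
  rightUnitor X := ObjectProperty.isoMk _ (Monoidal.rightUnitor X.obj)

instance : MonoidalCategory (FinGraded C) where
  tensorHom_def f g := ObjectProperty.hom_ext _ (Monoidal.tensorHom_def f.hom g.hom)
  id_tensorHom_id X Y := ObjectProperty.hom_ext _ (Monoidal.id_tensorHom_id X.obj Y.obj)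
  tensorHom_comp_tensorHom f₁ f₂ g₁ g₂ := ObjectProperty.hom_ext _
    (Monoidal.tensorHom_comp_tensorHom f₁.hom g₁.hom f₂.hom g₂.hom)
  whiskerLeft_id X Y := ObjectProperty.hom_ext _ (Monoidal.id_tensorHom_id X.obj Y.obj)
  id_whiskerRight X Y := ObjectProperty.hom_ext _ (Monoidal.id_tensorHom_id X.obj Y.obj)
  associator_naturality f₁ f₂ f₃ := ObjectProperty.hom_ext _
    (Monoidal.associator_naturality f₁.hom f₂.hom f₃.hom)
  leftUnitor_naturality f := ObjectProperty.hom_ext _ (Monoidal.leftUnitor_naturality f.hom)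
  rightUnitor_naturality f := ObjectProperty.hom_ext _ (Monoidal.rightUnitor_naturality f.hom)
  pentagon X₁ X₂ X₃ X₄ := ObjectProperty.hom_ext _
    (Monoidal.pentagon X₁.obj X₂.obj X₃.obj X₄.obj)
  triangle X Y := ObjectProperty.hom_ext _ (Monoidal.triangle X.obj Y.obj)

end Graded

section Complexes

variable (C : Type*) [Category* C]

/-- The property of being a bounded cochain complex. -/
def bounded [HasZeroMorphisms C] : ObjectProperty (CochainComplex C ℤ) :=
  fun K ↦ ∃ a b : ℤ, K.IsStrictlyGE a ∧ K.IsStrictlyLE b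

/-- The category of bounded cochain complexes. -/
abbrev Compb [HasZeroMorphisms C] := (bounded C).FullSubcategory

variable {C}

lemma bounded_of_finSupp [HasZeroMorphisms C] (K : CochainComplex C ℤ) [h : FinSupp K.X] :
    bounded C K := by
  obtain ⟨s, hs, hs'⟩ := h.out
  obtain ⟨a, ha⟩ := hs.bddBelow
  obtain ⟨b, hb⟩ := hs.bddAbove
  refine ⟨a, b, (CochainComplex.isStrictlyGE_iff _ _).2 fun i hi ↦ hs' i fun h ↦ ?_,
    (CochainComplex.isStrictlyLE_iff _ _).2 fun i hi ↦ hs' i fun h ↦ ?_⟩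
  · have := ha h
    lia
  · have := hb h
    lia

instance finSupp_X [HasZeroMorphisms C] (K : Compb C) : FinSupp K.obj.X := by
  obtain ⟨a, b, h₁, h₂⟩ := K.property
  refine ⟨Set.Icc a b, Set.finite_Icc a b, fun i hi ↦ ?_⟩
  by_cases h : a ≤ i
  · exact K.obj.isZero_of_isStrictlyLE b i (by
      by_contra h'
      exact hi ⟨h, by lia⟩)
  · exact K.obj.isZero_of_isStrictlyGE a i (by lia)

variable [MonoidalCategory C] [Preadditive C] [MonoidalPreadditive C] [HasZeroObject C]
  [HasFiniteCoproducts C]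

instance finSupp_tensorObj (K L : Compb C) :
    FinSupp (HomologicalComplex.tensorObj K.obj L.obj).X :=
  inferInstanceAs (FinSupp (GradedObject.Monoidal.tensorObj K.obj.X L.obj.X))

instance finSupp_single : FinSupp (HomologicalComplex.tensorUnit C (.up ℤ)).X :=
  ⟨{0}, Set.finite_singleton _, fun _ hi ↦
    HomologicalComplex.isZero_single_obj_X (.up ℤ) 0 (𝟙_ C) _ hi⟩

/-- The total tensor product of bounded complexes, with the usual sign conventions. -/
instance compbStruct : MonoidalCategoryStruct (Compb C) where
  tensorObj K L := ⟨HomologicalComplex.tensorObj K.obj L.obj, bounded_of_finSupp _⟩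
  tensorHom f g := ⟨HomologicalComplex.tensorHom f.hom g.hom⟩
  whiskerLeft K _ _ g := ⟨HomologicalComplex.tensorHom (𝟙 K.obj) g.hom⟩
  whiskerRight f L := ⟨HomologicalComplex.tensorHom f.hom (𝟙 L.obj)⟩
  tensorUnit := ⟨HomologicalComplex.tensorUnit C (.up ℤ), bounded_of_finSupp _⟩
  associator K L M := ObjectProperty.isoMk _ (HomologicalComplex.associator K.obj L.obj M.obj)
  leftUnitor K := ObjectProperty.isoMk _ (HomologicalComplex.leftUnitor K.obj)
  rightUnitor K := ObjectProperty.isoMk _ (HomologicalComplex.rightUnitor K.obj)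

/-- The functor that forgets the differentials. -/
def forgetDiff : Compb C ⥤ FinGraded C :=
  ObjectProperty.lift _ ((bounded C).ι ⋙ HomologicalComplex.forget C (.up ℤ))
    (fun K ↦ finSupp_X K)

instance : (forgetDiff (C := C)).Faithful where
  map_injective h := ObjectProperty.hom_ext _
    ((HomologicalComplex.forget C (.up ℤ)).map_injective
      (congrArg (fun φ ↦ φ.hom) h))

lemma aux_associator {D : Type*} [Category* D] [MonoidalCategory D] (X Y Z : D) :
    (α_ X Y Z).hom = (((Iso.refl ((X ⊗ Y) ⊗ Z)).symm ≪≫ ((Iso.refl (X ⊗ Y)).symm ⊗ᵢ .refl Z)) ≪≫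
      α_ X Y Z ≪≫ ((.refl X ⊗ᵢ Iso.refl (Y ⊗ Z)) ≪≫ Iso.refl (X ⊗ (Y ⊗ Z)))).hom := by
  simp

/-- The operations on bounded complexes are those of graded objects. -/
def forgetDiffData : Monoidal.InducingFunctorData (forgetDiff (C := C)) where
  μIso _ _ := Iso.refl _
  εIso := ObjectProperty.isoMk _ (HomologicalComplex.tensorUnitIso C (.up ℤ))
  whiskerLeft_eq K _ _ g := by
    erw [Category.comp_id, Category.id_comp]; rfl
  whiskerRight_eq f L := by
    erw [Category.comp_id, Category.id_comp]; rfl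
  tensorHom_eq f g := by
    erw [Category.comp_id, Category.id_comp]; rfl
  associator_eq K L M :=
    (aux_associator (forgetDiff.obj K) (forgetDiff.obj L) (forgetDiff.obj M) :)
  leftUnitor_eq K := by
    rw [Iso.trans_hom, Iso.trans_hom]
    erw [Category.id_comp]
    rfl
  rightUnitor_eq K := by
    rw [Iso.trans_hom, Iso.trans_hom]
    erw [Category.id_comp]
    rfl

instance compbMonoidal : MonoidalCategory (Compb C) :=
  Monoidal.induced _ (forgetDiffData (C := C))

end Complexes

section Localization

open HomologicalComplex Pretriangulated HomotopicalAlgebra ZeroObject DerivedCategory.TStructure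

variable (C : Type*) [Category* C] [Abelian C]

/-- The bounded above objects in the homotopy category of bounded below complexes. -/
def hbounded : ObjectProperty (HomotopyCategory.Plus C) :=
  fun K ↦ ∃ b : ℤ, CochainComplex.IsStrictlyLE K.obj.as b

variable {C}

instance : (hbounded C).ContainsZero where
  exists_zero :=
    ⟨(HomotopyCategory.Plus.quotient C).obj ⟨0, ⟨0, inferInstance⟩⟩,
      (IsZero.iff_id_eq_zero _).2 (ObjectProperty.hom_ext _
        ((IsZero.iff_id_eq_zero _).1
          ((HomotopyCategory.quotient C (.up ℤ)).map_isZero (isZero_zero _)))),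
      ⟨0, inferInstanceAs (CochainComplex.IsStrictlyLE (0 : CochainComplex C ℤ) 0)⟩⟩

instance : (hbounded C).IsStableUnderShift ℤ where
  isStableUnderShiftBy n :=
    { le_shift := by
        rintro ⟨⟨K⟩, hK⟩ ⟨b, hb⟩
        have : CochainComplex.IsStrictlyLE K b := hb
        have h := CochainComplex.isStrictlyLE_shift K b n (b - n) (by lia)
        refine ⟨b - n, ?_⟩
        have e : ((shiftFunctor (HomotopyCategory.Plus C) n).obj ⟨⟨K⟩, hK⟩).obj =
            (HomotopyCategory.quotient C (.up ℤ)).obj ((shiftFunctor (CochainComplex C ℤ) n).obj K) :=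
          Eq.trans (by with_unfolding_all rfl) (HomotopyCategory.shift_quotient_obj K n)
        rw [e]
        exact h }

lemma isStrictlyLE_mappingCone {K L : CochainComplex C ℤ} (f : K ⟶ L) (a b : ℤ)
    [K.IsStrictlyLE a] [L.IsStrictlyLE b] :
    (CochainComplex.mappingCone f).IsStrictlyLE (max a b) := by
  rw [CochainComplex.isStrictlyLE_iff]
  intro i hi
  rw [CochainComplex.mappingCone.isZero_X_iff]
  exact ⟨K.isZero_of_isStrictlyLE a _ (by lia), L.isZero_of_isStrictlyLE b _ (by lia)⟩

instance : (hbounded C).IsTriangulatedClosed₃ where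
  ext₃' T hT h₁ h₂ := by
    obtain ⟨b₁, _⟩ := h₁
    obtain ⟨b₂, _⟩ := h₂
    obtain ⟨a₁, _⟩ := (HomotopyCategory.plus_quotient_obj_iff T.obj₁.obj.as).1 T.obj₁.property
    obtain ⟨a₂, _⟩ := (HomotopyCategory.plus_quotient_obj_iff T.obj₂.obj.as).1 T.obj₂.property
    obtain ⟨f, hf⟩ := (HomotopyCategory.quotient C (.up ℤ)).map_surjective
      (X := T.obj₁.obj.as) (Y := T.obj₂.obj.as) T.mor₁.hom
    let M : HomotopyCategory.Plus C := (HomotopyCategory.Plus.quotient C).obj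
      ⟨CochainComplex.mappingCone f, ⟨min (a₁ - 1) a₂,
        CochainComplex.isStrictlyGE_mappingCone f a₁ a₂ _ (by simp) (by simp)⟩⟩
    refine ⟨M, ⟨max b₁ b₂, isStrictlyLE_mappingCone f b₁ b₂⟩, ⟨?_⟩⟩
    refine (HomotopyCategory.Plus.fullyFaithfulι C).preimageIso ?_
    exact Triangle.π₃.mapIso (isoTriangleOfIso₁₂ _ _
      ((HomotopyCategory.Plus.ι C).map_distinguished _ hT)
      (HomotopyCategory.mappingCone_triangleh_distinguished f)
      (Iso.refl _) (Iso.refl _) (by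
        dsimp
        exact (Category.comp_id _).trans (hf.symm.trans (Category.id_comp _).symm)))

instance : (hbounded C).IsTriangulated where
  toIsTriangulatedClosed₂ := .of_isTriangulatedClosed₃

instance : (hbounded C).IsVerdierLeftLocalizing
    (HomotopyCategory.Plus.subcategoryAcyclic C) where
  fac {K L} φ hK hL := by
    obtain ⟨K, rfl⟩ := HomotopyCategory.Plus.quotient_obj_surjective K
    obtain ⟨L, rfl⟩ := HomotopyCategory.Plus.quotient_obj_surjective L
    obtain ⟨φ, rfl⟩ := (HomotopyCategory.Plus.quotient C).map_surjective φ
    obtain ⟨b, hb⟩ := hK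
    have hb : K.obj.IsStrictlyLE b := hb
    obtain ⟨a, ha⟩ := L.property
    have hL' : L.obj.Acyclic :=
      (HomotopyCategory.quotient_obj_mem_subcategoryAcyclic_iff_acyclic _).1 hL
    have : (L.obj.truncLE b).IsStrictlyGE a := by
      rw [CochainComplex.isStrictlyGE_iff]
      intro i hi
      have : Mono (L.obj.ιTruncLE b) :=
        inferInstanceAs (Mono (HomologicalComplex.ιTruncLE _ _))
      have : Mono ((L.obj.ιTruncLE b).f i) :=
        inferInstanceAs (Mono ((HomologicalComplex.eval C (.up ℤ) i).map (L.obj.ιTruncLE b)))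
      exact IsZero.of_mono ((L.obj.ιTruncLE b).f i) (L.obj.isZero_of_isStrictlyGE a i hi)
    let M : CochainComplex.Plus C := ⟨L.obj.truncLE b, ⟨a, this⟩⟩
    refine ⟨(HomotopyCategory.Plus.quotient C).obj M,
      (HomotopyCategory.Plus.quotient C).map
        (ObjectProperty.homMk (inv (K.obj.ιTruncLE b) ≫ CochainComplex.truncLEMap φ.hom b)),
      (HomotopyCategory.Plus.quotient C).map (ObjectProperty.homMk (L.obj.ιTruncLE b)),
      ⟨b, inferInstanceAs ((L.obj.truncLE b).IsStrictlyLE b)⟩, ?_, ?_⟩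
    · exact (HomotopyCategory.quotient_obj_mem_subcategoryAcyclic_iff_acyclic _).2 (hL'.truncLE _)
    · rw [← Functor.map_comp]
      congr 1
      ext1
      simp

variable (C) in
/-- The functor from bounded complexes to the bounded homotopy category. -/
def quotientb : Compb C ⥤ (hbounded C).FullSubcategory :=
  ObjectProperty.lift _
    (ObjectProperty.lift _ ((bounded C).ι ⋙ HomotopyCategory.quotient C (.up ℤ))
      (fun K ↦ by
        obtain ⟨a, b, ha, hb⟩ := K.property
        exact (HomotopyCategory.plus_quotient_obj_iff _).2 ⟨a, ha⟩))
    (fun K ↦ by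
      obtain ⟨a, b, ha, hb⟩ := K.property
      exact ⟨b, hb⟩)

instance : (quotientb C).Full := by
  dsimp [quotientb]
  infer_instance

instance : (quotientb C).EssSurj where
  mem_essImage K := by
    obtain ⟨⟨K, hK⟩, ⟨b, hb⟩⟩ := K
    obtain ⟨K, rfl⟩ := HomotopyCategory.quotient_obj_surjective K
    obtain ⟨a, ha⟩ := (HomotopyCategory.plus_quotient_obj_iff _).1 hK
    exact ⟨⟨K, ⟨a, b, ha, hb⟩⟩, ⟨Iso.refl _⟩⟩

lemma bounded_cylinder (K : CochainComplex C ℤ) (hK : bounded C K) :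
    bounded C (cylinder K) := by
  obtain ⟨a, b, ha, hb⟩ := hK
  obtain ⟨a', ha'⟩ := CochainComplex.plus_cylinder K ⟨a, ha⟩
  refine ⟨a', b, ha', ?_⟩
  rw [CochainComplex.isStrictlyLE_iff]
  intro i hi
  dsimp [cylinder]
  refine homotopyCofiber.isZero_X _ _ ?_ (fun j hj ↦ ?_)
  · refine IsZero.of_iso ?_ ((HomologicalComplex.eval C (.up ℤ) i).mapBiprod _ _)
    simpa using K.isZero_of_isStrictlyLE b i
  · simp only [ComplexShape.up_Rel] at hj
    exact K.isZero_of_isStrictlyLE b _ (by lia)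

instance : (quotientb C).IsLocalization
    ((homotopyEquivalences C (.up ℤ)).inverseImage (bounded C).ι) :=
  Functor.isLocalization_of_essSurj_of_full_of_exists_cylinders _ _
    (fun _ _ f hf ↦ by
      have h : IsIso ((HomotopyCategory.quotient C (.up ℤ)).map f.hom) := by
        have : (homotopyEquivalences C (.up ℤ)) f.hom := hf
        rwa [← HomotopyCategory.inverseImage_quotient_isomorphisms] at this
      rw [← isIso_iff_of_reflects_iso _ ((hbounded C).ι ⋙ HomotopyCategory.Plus.ι C)]
      exact h)
    (by
      rintro K L f₀ f₁ hf
      have hf' := HomotopyCategory.homotopyOfEq f₀.hom f₁.hom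
        (((hbounded C).ι ⋙ HomotopyCategory.Plus.ι C).congr_map hf)
      exact ⟨K.obj.precylinder.toFullSubcategory (bounded_cylinder K.obj K.property),
        Precylinder.LeftHomotopy.fullSubcategoryEquiv.symm
          { h := cylinder.desc _ _ hf'
            h₀ := cylinder.ι₀_desc _ _ hf'
            h₁ := cylinder.ι₁_desc _ _ hf' },
        ⟨cylinder.homotopyEquiv _ (fun n ↦ ⟨n - 1, by simp⟩), rfl⟩⟩)

variable [HasDerivedCategory C]

variable (C) in
/-- The functor from the bounded homotopy category to the bounded derived category. -/
def Qhb : (hbounded C).FullSubcategory ⥤ DerivedCategory.Bounded C :=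
  ObjectProperty.lift _
    ((hbounded C).ι ⋙ HomotopyCategory.Plus.ι C ⋙ DerivedCategory.Qh)
    (by
      rintro ⟨⟨K, hK⟩, ⟨b, hb⟩⟩
      obtain ⟨K, rfl⟩ := HomotopyCategory.quotient_obj_surjective K
      obtain ⟨a, ha⟩ := (HomotopyCategory.plus_quotient_obj_iff _).1 hK
      have : CochainComplex.IsStrictlyLE K b := hb
      exact ⟨⟨a, t.isGE_of_iso ((DerivedCategory.quotientCompQhIso C).symm.app K) a⟩,
        ⟨b, t.isLE_of_iso ((DerivedCategory.quotientCompQhIso C).symm.app K) b⟩⟩)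

instance : (Qhb C).EssSurj where
  mem_essImage := by
    rintro ⟨X, ⟨a, ha⟩, ⟨b, hb⟩⟩
    obtain ⟨K, h₁, h₂, ⟨e⟩⟩ := DerivedCategory.exists_iso_Q_obj_of_isGE_of_isLE X a b
    exact ⟨(quotientb C).obj ⟨K, ⟨a, b, h₁, h₂⟩⟩,
      ⟨(DerivedCategory.Bounded.ι).preimageIso
        ((DerivedCategory.quotientCompQhIso C).app K ≪≫ e.symm)⟩⟩

instance : (Qhb C).IsLocalization
    (ObjectProperty.trW ((HomotopyCategory.Plus.subcategoryAcyclic C).inverseImage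
      (hbounded C).ι)) := by
  let G : DerivedCategory.Bounded C ⥤ DerivedCategory.Plus C :=
    ObjectProperty.lift _ DerivedCategory.Bounded.ι (fun X ↦ X.property.1)
  exact ((hbounded C).triangulatedLocalizerMorphism
    (HomotopyCategory.Plus.subcategoryAcyclic C)).isLocalization_of_isLocalizedFullyFaithful
      (L₂ := DerivedCategory.Plus.Qh) (F := G) (Iso.refl _)

variable (C) in
/-- The quasi-isomorphisms between bounded complexes. -/
def quasiIsob : MorphismProperty (Compb C) :=
  (HomologicalComplex.quasiIso C (.up ℤ)).inverseImage (bounded C).ι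

variable (C) in
/-- The functor from bounded complexes to the bounded derived category. -/
def Qb : Compb C ⥤ DerivedCategory.Bounded C :=
  ObjectProperty.lift _ ((bounded C).ι ⋙ DerivedCategory.Q) (by
    rintro ⟨K, a, b, ha, hb⟩
    exact ⟨⟨a, inferInstanceAs ((DerivedCategory.Q.obj K).IsGE a)⟩,
      ⟨b, inferInstanceAs ((DerivedCategory.Q.obj K).IsLE b)⟩⟩)

variable (C) in
/-- `Qb` factors through the bounded homotopy category. -/
def QbIso : quotientb C ⋙ Qhb C ≅ Qb C :=
  ((ObjectProperty.fullyFaithfulι _).whiskeringRight _).preimageIso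
    (Functor.isoWhiskerLeft (bounded C).ι (DerivedCategory.quotientCompQhIso C))

instance : (Qb C).IsLocalization (quasiIsob C) := by
  have : (quotientb C ⋙ Qhb C).IsLocalization (quasiIsob C) := by
    refine Functor.IsLocalization.comp (quotientb C) (Qhb C)
      ((homotopyEquivalences C (.up ℤ)).inverseImage (bounded C).ι) 
      (ObjectProperty.trW ((HomotopyCategory.Plus.subcategoryAcyclic C).inverseImage
        (hbounded C).ι)) _ ?_ ?_ ?_
    · intro K L f hf
      rw [NatIso.isIso_map_iff (QbIso C),
        ← isIso_iff_of_reflects_iso _ DerivedCategory.Bounded.ι]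
      exact Localization.inverts DerivedCategory.Q (HomologicalComplex.quasiIso C (.up ℤ)) f.hom hf
    · intro K L f hf
      exact homotopyEquivalences_le_quasiIso _ _ _ hf
    · intro K L f hf
      obtain ⟨⟨⟨K⟩, hK⟩, ⟨b, hb⟩⟩ := K
      obtain ⟨⟨⟨L⟩, hL⟩, ⟨b', hb'⟩⟩ := L
      obtain ⟨a, ha⟩ := (HomotopyCategory.plus_quotient_obj_iff _).1 hK
      obtain ⟨a', ha'⟩ := (HomotopyCategory.plus_quotient_obj_iff _).1 hL
      let K' : Compb C := ⟨K, ⟨a, b, ha, hb⟩⟩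
      let L' : Compb C := ⟨L, ⟨a', b', ha', hb'⟩⟩
      obtain ⟨f, rfl⟩ := (quotientb C).map_surjective (X := K') (Y := L') f
      refine MorphismProperty.map_mem_map _ _ _ ?_
      have hf' := ((hbounded C).trW_inverseImage_ι_iff
        (HomotopyCategory.Plus.subcategoryAcyclic C) _).1 hf
      replace hf' := ObjectProperty.trW_monotone inf_le_right _ hf'
      rw [← HomotopyCategory.Plus.quasiIso_eq_subcategoryAcyclic_trW] at hf'
      exact (HomotopyCategory.quotient_map_mem_quasiIso_iff f.hom).1 hf'
  exact Functor.IsLocalization.of_iso _ (QbIso C)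

end Localization

section Monoidal

open HomologicalComplex

variable {C D : Type*} [Category* C] [Category* D] [MonoidalCategory C] [MonoidalCategory D]
  [Preadditive C] [Preadditive D] [MonoidalPreadditive C] [MonoidalPreadditive D]
  [HasZeroObject C] [HasZeroObject D] [HasFiniteCoproducts C] [HasFiniteCoproducts D]

lemma aux_add_comp {C : Type*} [Category* C] [Preadditive C] {A B B' E Z : C} (a : A ⟶ B) (i : B ⟶ E) (b : A ⟶ B') (i' : B' ⟶ E)
    (s : ℤˣ) (x : E ⟶ Z) (y : B ⟶ Z) (y' : B' ⟶ Z) (h : i ≫ x = y) (h' : i' ≫ x = y') :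
    (a ≫ i + s • b ≫ i') ≫ x = a ≫ y + s • b ≫ y' := by
  rw [Preadditive.add_comp, Linear.units_smul_comp, Category.assoc, Category.assoc, h, h']

lemma ι_tensor_d (K L : CochainComplex C ℤ) [FinSupp K.X] [FinSupp L.X] (i j n n' : ℤ)
    (h : i + j = n) (h' : n + 1 = n') :
    ιTensorObj K L i j n h ≫ (tensorObj K L).d n n' =
      K.d i (i + 1) ▷ L.X j ≫ ιTensorObj K L (i + 1) j n' (by lia) +
        i.negOnePow • K.X i ◁ L.d j (j + 1) ≫ ιTensorObj K L i (j + 1) n' (by lia) := by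
  rw [mapBifunctor.d_eq, Preadditive.comp_add, mapBifunctor.ι_D₁, mapBifunctor.ι_D₂,
    mapBifunctor.d₁_eq _ _ _ _ (i₁ := i) (i₁' := i + 1) rfl _ _ (show i + 1 + j = n' by lia),
    mapBifunctor.d₂_eq _ _ _ _ _ (i₂ := j) (i₂' := j + 1) rfl _ (show i + (j + 1) = n' by lia)]
  have h₁ : ComplexShape.ε₁ (.up ℤ) (.up ℤ) (.up ℤ) (i, j) = 1 := rfl
  have h₂ : ComplexShape.ε₂ (.up ℤ) (.up ℤ) (.up ℤ) (i, j) = i.negOnePow := rfl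
  rw [h₁, h₂, one_smul]
  rfl

lemma ι_tensorHom {K K' L L' : CochainComplex C ℤ} [FinSupp K.X] [FinSupp L.X]
    [FinSupp K'.X] [FinSupp L'.X] (f : K ⟶ K') (g : L ⟶ L') (i j n : ℤ) (h : i + j = n) :
    ιTensorObj K L i j n h ≫ (HomologicalComplex.tensorHom f g).f n =
      (f.f i ⊗ₘ g.f j) ≫ ιTensorObj K' L' i j n h := by
  rw [MonoidalCategory.tensorHom_def, Category.assoc]
  exact ι_mapBifunctorMap f g (curriedTensor C) (.up ℤ) i j n h

variable (F : C ⥤ D) [F.Monoidal] [F.Additive]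

/-- The functor between complexes induced by an additive functor. -/
abbrev mapC : CochainComplex C ℤ ⥤ CochainComplex D ℤ := F.mapHomologicalComplex (.up ℤ)

instance finSupp_map (K : CochainComplex C ℤ) [hK : FinSupp K.X] :
    FinSupp ((mapC F).obj K).X := by
  obtain ⟨s, hs, hs'⟩ := hK.out
  exact ⟨s, hs, fun i hi ↦ F.map_isZero (hs' i hi)⟩

variable (K L : CochainComplex C ℤ) [FinSupp K.X] [FinSupp L.X]

open Functor.LaxMonoidal Functor.OplaxMonoidal Functor.Monoidal

/-- The components of `mapTensor`. -/
def mapTensorX (n : ℤ) : (tensorObj ((mapC F).obj K) ((mapC F).obj L)).X n ⟶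
    F.obj ((tensorObj K L).X n) :=
  mapBifunctorDesc (fun i j h ↦ μ F (K.X i) (L.X j) ≫ F.map (ιTensorObj K L i j n h))

lemma ι_mapTensorX (i j n : ℤ) (h : i + j = n) :
    ιTensorObj ((mapC F).obj K) ((mapC F).obj L) i j n h ≫ mapTensorX F K L n =
      μ F (K.X i) (L.X j) ≫ F.map (ιTensorObj K L i j n h) :=
  ι_mapBifunctorDesc _ _ _ _

/-- The compatibility of a monoidal functor with the tensor product of complexes. -/
def mapTensor : tensorObj ((mapC F).obj K) ((mapC F).obj L) ⟶ (mapC F).obj (tensorObj K L) where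
  f n := mapTensorX F K L n
  comm' m n hmn := by
    refine mapBifunctor.hom_ext (fun i j h ↦ ?_)
    have h₁ := ι_tensor_d K L i j m n h hmn
    have h₂ := ι_tensor_d ((mapC F).obj K) ((mapC F).obj L) i j m n h hmn
    have h₃ := ι_mapTensorX F K L i j m h
    have h₄ := ι_mapTensorX F K L (i + 1) j n (by simp at hmn; lia)
    have h₅ := ι_mapTensorX F K L i (j + 1) n (by simp at hmn; lia)
    have h₆ := congrArg F.map h₁
    have h₇ := μ_natural_left F (K.d i (i + 1)) (L.X j)
    have h₈ := μ_natural_right F (K.X i) (L.d j (j + 1))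
    simp only [F.map_add, F.map_comp, Functor.map_units_smul] at h₆
    have key : (μ F (K.X i) (L.X j) ≫ F.map (ιTensorObj K L i j m h)) ≫
        F.map ((tensorObj K L).d m n) =
        F.map (K.d i (i + 1)) ▷ F.obj (L.X j) ≫
          μ F (K.X (i + 1)) (L.X j) ≫ F.map (ιTensorObj K L (i + 1) j n (by simp at hmn; lia)) +
        i.negOnePow • F.obj (K.X i) ◁ F.map (L.d j (j + 1)) ≫
          μ F (K.X i) (L.X (j + 1)) ≫
            F.map (ιTensorObj K L i (j + 1) n (by simp at hmn; lia)) := by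
      rw [Category.assoc, h₆, reassoc_of% h₇, reassoc_of% h₈, Preadditive.comp_add,
        Linear.comp_units_smul]
    exact ((reassoc_of% h₃) (F.map ((tensorObj K L).d m n))).trans
      (key.trans (((reassoc_of% h₂) (mapTensorX F K L n)).trans
        (aux_add_comp _ _ _ _ _ _ _ _ h₄ h₅)).symm)

lemma isIso_mapTensorX (n : ℤ) : IsIso (mapTensorX F K L n) := by
  obtain ⟨s, hs, hs'⟩ := exists_finite_pair K.X L.X
  let f : {p : ℤ × ℤ // p.1 + p.2 = n} → C := fun p ↦ K.X p.1.1 ⊗ L.X p.1.2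
  let c : Cofan f := Cofan.mk ((tensorObj K L).X n) (fun p ↦ ιTensorObj K L p.1.1 p.1.2 n p.2)
  have : HasCoproduct f := hasCoproduct_of_finite (s := Subtype.val ⁻¹' s)
    (hs.preimage Subtype.val_injective.injOn) (fun i hi ↦ hs' i.1 hi)
  have hc : IsColimit c := coproductIsCoproduct f
  have : PreservesColimit (Discrete.functor f) F :=
    preservesColimit_of_finite (s := Subtype.val ⁻¹' s) _
      (hs.preimage Subtype.val_injective.injOn) (fun i hi ↦ hs' i.1 hi)
  let c' : Cofan (fun p ↦ F.obj (f p)) := Cofan.mk (F.obj ((tensorObj K L).X n))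
    (fun p ↦ F.map (ιTensorObj K L p.1.1 p.1.2 n p.2))
  have hc' : IsColimit c' := isColimitCofanMkObjOfIsColimit F _ _ hc
  let g (p) : F.obj (f p) ⟶ (tensorObj ((mapC F).obj K) ((mapC F).obj L)).X n :=
    δ F _ _ ≫ ιTensorObj ((mapC F).obj K) ((mapC F).obj L) p.1.1 p.1.2 n p.2
  have hg (p) : c'.inj p ≫ Cofan.IsColimit.desc hc' g = g p :=
    Cofan.IsColimit.fac hc' g p
  refine ⟨Cofan.IsColimit.desc hc' g, ?_, Cofan.IsColimit.hom_ext hc' _ _ (fun p ↦ ?_)⟩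
  · refine mapBifunctor.hom_ext (K₁ := (mapC F).obj K) (K₂ := (mapC F).obj L)
      (F := curriedTensor D) (c := .up ℤ) (fun i j h ↦ ?_)
    have h₁ := ι_mapTensorX F K L i j n h
    have h₂ := hg ⟨(i, j), h⟩
    refine ((reassoc_of% h₁) _).trans (.trans ?_ (Category.comp_id _).symm)
    refine (Category.assoc _ _ _).trans ((congrArg _ h₂).trans ?_)
    exact (Category.assoc _ _ _).symm.trans
      ((congrArg (· ≫ _) (μ_δ F (K.X i) (L.X j))).trans (Category.id_comp _))
  · have h₁ := ι_mapTensorX F K L p.1.1 p.1.2 n p.2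
    refine ((reassoc_of% (hg p)) _).trans (.trans ?_ (Category.comp_id _).symm)
    refine (Category.assoc _ _ _).trans ((congrArg _ h₁).trans ?_)
    exact (Category.assoc _ _ _).symm.trans
      ((congrArg (· ≫ _) (δ_μ F (K.X p.1.1) (L.X p.1.2))).trans (Category.id_comp _))

instance : IsIso (mapTensor F K L) := by
  have (n : ℤ) : IsIso ((mapTensor F K L).f n) := isIso_mapTensorX F K L n
  exact Hom.isIso_of_components _

lemma mapTensor_naturality {K K' L L' : CochainComplex C ℤ} [FinSupp K.X] [FinSupp L.X]
    [FinSupp K'.X] [FinSupp L'.X] (f : K ⟶ K') (g : L ⟶ L') :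
    mapTensor F K L ≫ (mapC F).map (HomologicalComplex.tensorHom f g) =
      HomologicalComplex.tensorHom ((mapC F).map f) ((mapC F).map g) ≫ mapTensor F K' L' := by
  ext n i j h
  have h₁ := ι_mapTensorX F K L i j n h
  have h₂ := ι_mapTensorX F K' L' i j n h
  have h₅ := congrArg F.map (ι_tensorHom f g i j n h)
  simp only [F.map_comp] at h₅
  have key : (μ F (K.X i) (L.X j) ≫ F.map (ιTensorObj K L i j n h)) ≫
      F.map ((HomologicalComplex.tensorHom f g).f n) = (F.map (f.f i) ⊗ₘ F.map (g.f j)) ≫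
        μ F (K'.X i) (L'.X j) ≫ F.map (ιTensorObj K' L' i j n h) := by
    rw [Category.assoc, h₅, μ_natural_assoc]
  exact ((reassoc_of% h₁) (F.map ((HomologicalComplex.tensorHom f g).f n))).trans
    (key.trans (((reassoc_of% (ι_tensorHom ((mapC F).map f)
      ((mapC F).map g) i j n h)) (mapTensorX F K' L' n)).trans
        (congrArg _ h₂)).symm)

end Monoidal

section Homotopy

open HomologicalComplex

variable {C : Type*} [Category* C] [MonoidalCategory C] [Preadditive C] [MonoidalPreadditive C]
  [HasZeroObject C] [HasFiniteCoproducts C]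

lemma tensorHom_comp {K K' K'' L L' L'' : CochainComplex C ℤ} [FinSupp K.X] [FinSupp L.X]
    [FinSupp K'.X] [FinSupp L'.X] [FinSupp K''.X] [FinSupp L''.X]
    (f : K ⟶ K') (f' : K' ⟶ K'') (g : L ⟶ L') (g' : L' ⟶ L'') :
    HomologicalComplex.tensorHom f g ≫ HomologicalComplex.tensorHom f' g' =
      HomologicalComplex.tensorHom (f ≫ f') (g ≫ g') := by
  ext n i j h
  refine ((reassoc_of% (ι_tensorHom f g i j n h)) _).trans ?_
  refine (congrArg _ (ι_tensorHom f' g' i j n h)).trans ?_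
  refine .trans ?_ (ι_tensorHom (f ≫ f') (g ≫ g') i j n h).symm
  simp [MonoidalCategory.tensorHom_comp_tensorHom_assoc]

lemma tensorHom_id (K L : CochainComplex C ℤ) [FinSupp K.X] [FinSupp L.X] :
    HomologicalComplex.tensorHom (𝟙 K) (𝟙 L) = 𝟙 (tensorObj K L) := by
  ext n i j h
  refine (ι_tensorHom (𝟙 K) (𝟙 L) i j n h).trans ?_
  simp

/-- The tensor product of homotopies. -/
def tensorHomotopy {K K' L L' : CochainComplex C ℤ} [FinSupp K.X] [FinSupp L.X]
    [FinSupp K'.X] [FinSupp L'.X] {f f' : K ⟶ K'} {g g' : L ⟶ L'}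
    (h : Homotopy f f') (h' : Homotopy g g') :
    Homotopy (HomologicalComplex.tensorHom f g) (HomologicalComplex.tensorHom f' g') :=
  (mapBifunctorMapHomotopy₁ h g (curriedTensor C) (.up ℤ)).trans
    (mapBifunctorMapHomotopy₂ f' h' (curriedTensor C) (.up ℤ))

/-- The tensor product of homotopy equivalences. -/
def tensorHomotopyEquiv {K K' L L' : CochainComplex C ℤ} [FinSupp K.X] [FinSupp L.X]
    [FinSupp K'.X] [FinSupp L'.X] (e : HomotopyEquiv K K') (e' : HomotopyEquiv L L') :
    HomotopyEquiv (tensorObj K L) (tensorObj K' L') where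
  hom := HomologicalComplex.tensorHom e.hom e'.hom
  inv := HomologicalComplex.tensorHom e.inv e'.inv
  homotopyHomInvId := (Homotopy.ofEq (tensorHom_comp _ _ _ _)).trans
    ((tensorHomotopy e.homotopyHomInvId e'.homotopyHomInvId).trans (.ofEq (tensorHom_id _ _)))
  homotopyInvHomId := (Homotopy.ofEq (tensorHom_comp _ _ _ _)).trans
    ((tensorHomotopy e.homotopyInvHomId e'.homotopyInvHomId).trans (.ofEq (tensorHom_id _ _)))

end Homotopy

section Injective

open HomologicalComplex

variable {C : Type*} [Category* C] [Abelian C]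

lemma exists_homotopyEquiv (hC : ∀ X : C, Injective X) {K L : CochainComplex C ℤ}
    [FinSupp K.X] [FinSupp L.X] (f : K ⟶ L) [QuasiIso f] :
    ∃ e : HomotopyEquiv K L, e.hom = f := by
  have h (K : CochainComplex C ℤ) [FinSupp K.X] : K.IsKInjective := by
    obtain ⟨a, b, ha, hb⟩ := bounded_of_finSupp K
    exact CochainComplex.isKInjective_of_injective K a
  have := h K
  have := h L
  obtain ⟨e, he⟩ := (CochainComplex.IsKInjective.quasiIso_iff f).1 inferInstance
  exact ⟨e, he⟩

variable [MonoidalCategory C] [MonoidalPreadditive C]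

lemma quasiIso_tensorHom (hC : ∀ X : C, Injective X) {K L K' L' : CochainComplex C ℤ}
    [FinSupp K.X] [FinSupp L.X] [FinSupp K'.X] [FinSupp L'.X]
    (f : K ⟶ K') (g : L ⟶ L') [QuasiIso f] [QuasiIso g] :
    QuasiIso (HomologicalComplex.tensorHom f g) := by
  obtain ⟨e, rfl⟩ := exists_homotopyEquiv hC f
  obtain ⟨e', rfl⟩ := exists_homotopyEquiv hC g
  exact (tensorHomotopyEquiv e e').quasiIso_hom

end Injective

section Rep
universe u v w

/-- Finite-dimensional representations over `k` of the quiver `Q`. -/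
abbrev Rep (k : Type u) [Field k] (Q : Type w) [Quiver.{v} Q] := Paths Q ⥤ FGModuleCat.{u} k

variable (k : Type u) [Field k] (Q : Type w) [Quiver.{v} Q]

instance : MonoidalPreadditive (FGModuleCat.{u} k) := by infer_instance

instance : MonoidalPreadditive (Rep k Q) where
  whiskerLeft_zero := by intros; ext1; ext1 v; exact MonoidalPreadditive.whiskerLeft_zero
  zero_whiskerRight := by intros; ext1; ext1 v; exact MonoidalPreadditive.zero_whiskerRight
  whiskerLeft_add _ _ := by ext1; ext1 v; exact MonoidalPreadditive.whiskerLeft_add _ _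
  add_whiskerRight _ _ := by ext1; ext1 v; exact MonoidalPreadditive.add_whiskerRight _ _

instance (X : FGModuleCat.{u} k) : Injective X where
  factors {A B} g f hf := by
    have : Mono ((forget₂ _ (ModuleCat.{u} k)).map f) := inferInstance
    have hf := (ModuleCat.mono_iff_injective _).1 this
    obtain ⟨r, hr⟩ := LinearMap.exists_leftInverse_of_injective (f.hom.hom)
      (LinearMap.ker_eq_bot.2 hf)
    refine ⟨ObjectProperty.homMk (ModuleCat.ofHom r) ≫ g, ?_⟩
    rw [← Category.assoc]
    convert Category.id_comp g
    ext x
    exact LinearMap.congr_fun hr x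

variable {Q} in
/-- The evaluation of representations at a vertex. -/
abbrev ev (v : Q) : Rep k Q ⥤ FGModuleCat.{u} k := (evaluation _ _).obj ((Paths.of Q).obj v)

instance (v : Q) : (ev k v).Monoidal :=
  Functor.CoreMonoidal.toMonoidal
    { εIso := Iso.refl _
      μIso _ _ := Iso.refl _ }

lemma jointlyReflects : JointlyReflectIsomorphisms (fun v : Q ↦ ev k v) where
  isIso {X Y} f hf := by
    have (v : Paths Q) : IsIso (f.app v) := hf v
    exact NatIso.isIso_of_isIso_app f

lemma quasiIso_iff_ev {K L : CochainComplex (Rep k Q) ℤ} (f : K ⟶ L) :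
    QuasiIso f ↔ ∀ v, QuasiIso ((mapC (ev k v)).map f) :=
  (jointlyReflects k Q).quasiIso_iff f

instance : (quasiIsob (Rep k Q)).IsMonoidal := by
  have : (quasiIsob (Rep k Q)).IsMultiplicative := by
    dsimp [quasiIsob]
    infer_instance
  refine .mk' _ (fun {K K' L L'} f g hf hg ↦ ?_)
  refine (quasiIso_iff_ev k Q _).2 (fun v ↦ ?_)
  have := (quasiIso_iff_ev k Q f.hom).1 hf v
  have := (quasiIso_iff_ev k Q g.hom).1 hg v
  have h := mapTensor_naturality (ev k v) f.hom g.hom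
  have := quasiIso_tensorHom (fun _ ↦ inferInstance)
    ((mapC (ev k v)).map f.hom) ((mapC (ev k v)).map g.hom)
  have h' : QuasiIso (mapTensor (ev k v) K.obj L.obj ≫
      (mapC (ev k v)).map (HomologicalComplex.tensorHom f.hom g.hom)) := by
    rw [h]
    infer_instance
  exact (quasiIso_iff_comp_left (mapTensor (ev k v) K.obj L.obj) _).1 h'

instance : HasDerivedCategory (Rep k Q) := .standard _

/-- The bounded derived category of the finite-dimensional representations of a quiver. -/
abbrev Db := DerivedCategory.Bounded (Rep k Q)

/-- The monoidal structure on the bounded derived category that is induced by the vertex-wise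
tensor product: it is the localization of the total tensor product of bounded complexes. -/
instance : MonoidalCategory (Db k Q) :=
  inferInstanceAs (MonoidalCategory
    (LocalizedMonoidal (Qb (Rep k Q)) (quasiIsob (Rep k Q)) (Iso.refl _)))

/-- The localization functor from bounded complexes is monoidal. -/
instance : (Qb (Rep k Q)).Monoidal :=
  inferInstanceAs (@Functor.Monoidal _ _ _ _ _ (inferInstanceAs (MonoidalCategory
    (LocalizedMonoidal (Qb (Rep k Q)) (quasiIsob (Rep k Q)) (Iso.refl _))))
      (Localization.Monoidal.toMonoidalCategory
        (Qb (Rep k Q)) (quasiIsob (Rep k Q)) (Iso.refl _)))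

end Rep

section Quivers

/-- A quiver with finitely many vertices and arrows, and no oriented cycle. -/
structure IsFiniteAcyclic (Q : Type*) [Quiver Q] : Prop where
  finite_vertices : Finite Q
  finite_arrows (a b : Q) : Finite (a ⟶ b)
  acyclic (a : Q) (p : Quiver.Path a a) : p = .nil

/-- An isomorphism of quivers: a bijection on vertices and a bijection on arrows that are
compatible with the sources and the targets. -/
structure QuiverIso (Q Q' : Type*) [Quiver Q] [Quiver Q'] where
  obj : Q ≃ Q'
  hom (a b : Q) : (a ⟶ b) ≃ (obj a ⟶ obj b)

end Quivers

end QuiverDb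

end

/-!
For a vertex `v` let `S v` be the simple representation at `v`. The proof recovers the vertices of
the quiver from the objects `S v` of the bounded derived category, and the number of arrows `a → b`
as the dimension of `Hom(S a, (S b)⟦1⟧)`.

A monoidal equivalence `F` that commutes with the shifts permutes the `S v`. The tensor product with
`S v` keeps the cohomology at the vertex `v` and kills it at all other vertices. An object `X` with
cohomology only at `v` has a shift `(S v)⟦-m⟧` as a direct factor whenever its cohomology is nonzero
in degree `m` (`exists_retract_of_support`): as `Q` has no oriented cycle, the part `X_v` placed at
`v` is a quotient of a subobject of `X`, both maps being quasi-isomorphisms, and a complex of vector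
spaces splits. Now `F (S a)` is nonzero, so `F (S a) ⊗ S v` is nonzero for some `v`. Writing `S v`
as `F Y`, a shift of `S a` is a direct factor of `S a ⊗ Y`, so that a shift of `F (S a)` is a direct
factor of `F (S a) ⊗ S v` and has cohomology only at `v`. Its idempotent endomorphisms are trivial,
like those of `S a`, and it has a shift of `S v` as a direct factor: it is a shift of `S v`
(`exists_map_simpleb_iso_shift`). There is no shift, because `S a` is a direct factor of
`S a ⊗ S a`, while `(S v)⟦-p⟧ ⊗ (S v)⟦-p⟧` lives in degree `2 * p` (`exists_map_simpleb_iso`).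

The dimension of `Hom(S a, (S b)⟦1⟧)` is computed with the extension `E` of `S a` by one copy of
`S b` for each arrow `a → b`, each arrow sending the generator at `a` to its own basis vector. No
nonzero map from the kernel of `E → S a` to `S b` extends to `E`, and `E → S a` lifts to every
extension of `S a` by `S b`. So the connecting map from the maps between this kernel and `S b` to
`Hom(S a, (S b)⟦1⟧)` is bijective (`connecting_bijective`, `finrank_hom_simpleb_shift`).
-/

noncomputable section

namespace QuiverDb

universe u v w v' w'

/-! ### Representations, and the part of a representation at a vertex -/

section Representations

variable {k : Type u} [Field k] {Q : Type w} [Quiver.{v} Q]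

/-- A family of maps at the vertices that commutes with the arrows is a map of representations: `Rep
k Q` consists of functors on the path category, so that naturality for paths is the content. -/
def Rep.homMk {M N : Rep k Q} (app : ∀ v : Q, (ev k v).obj M ⟶ (ev k v).obj N)
    (naturality : ∀ {a b : Q} (α : a ⟶ b),
      M.map ((Paths.of Q).map α) ≫ app b = app a ≫ N.map ((Paths.of Q).map α)) : M ⟶ N where
  app v := app v
  naturality a b p := by
    induction p using Paths.induction with
    | id =>
      rw [M.map_id, N.map_id]
      exact (Category.id_comp _).trans (Category.comp_id _).symm
    | comp p q h =>
      rw [Functor.map_comp, Functor.map_comp]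
      exact (Category.assoc _ _ _).trans ((congrArg _ (naturality q)).trans
        ((Category.assoc _ _ _).symm.trans ((congrArg (· ≫ _) h).trans (Category.assoc _ _ _))))

lemma Rep.hom_ext' {M N : Rep k Q} {f g : M ⟶ N}
    (h : ∀ v : Q, (ev k v).map f = (ev k v).map g) : f = g :=
  NatTrans.ext (funext h)

/-- The representation given by its values at the vertices and on the arrows. -/
def Rep.mk (V : Q → FGModuleCat.{u} k) (f : ∀ {a b : Q}, (a ⟶ b) → (V a ⟶ V b)) : Rep k Q :=
  Paths.lift { obj := V, map := f }

@[simp]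
lemma Rep.mk_map (V : Q → FGModuleCat.{u} k) (f : ∀ {a b : Q}, (a ⟶ b) → (V a ⟶ V b))
    {a b : Q} (α : a ⟶ b) :
    (Rep.mk V f).map ((Paths.of Q).map α) = f α :=
  Category.id_comp _

/-- The subspace of `V` that is `V` if `P` holds and zero otherwise. Being a submodule in both
cases, it allows constructions by cases on vertices without casts between types. -/
def gate (P : Prop) (V : FGModuleCat.{u} k) : Submodule k V where
  carrier := {x | x ≠ 0 → P}
  add_mem' {x y} hx hy h := by
    by_contra hP
    simp_all
  zero_mem' h := (h rfl).elim
  smul_mem' c x hx h := hx (fun h' ↦ h (by simp [h']))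

lemma eq_zero_of_mem_gate {P : Prop} {V : FGModuleCat.{u} k} {x : V} (hx : x ∈ gate P V)
    (hP : ¬ P) : x = 0 := by
  by_contra h
  exact hP (hx h)

/-- The subspace `gate P V` as an object of the category of finite-dimensional spaces. -/
abbrev gated (P : Prop) (V : FGModuleCat.{u} k) : FGModuleCat.{u} k :=
  FGModuleCat.of k (gate P V)

/-- The restriction of a linear map to `gate P V` and `gate P' V'`. -/
def gatedMap {P P' : Prop} {V V' : FGModuleCat.{u} k} (f : V ⟶ V') (h : P → P') :
    gated P V ⟶ gated P' V' :=
  FGModuleCat.ofHom (f.hom.hom.restrict (p := gate P V) (q := gate P' V')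
    (fun x hx hx' ↦ h (hx (fun h' ↦ hx' (by simp [h'])))))

/-- The inclusion of `gate P V` into `V`. -/
def gatedι (P : Prop) (V : FGModuleCat.{u} k) : gated P V ⟶ V :=
  ObjectProperty.homMk (ModuleCat.ofHom (gate P V).subtype)

instance (P : Prop) (V : FGModuleCat.{u} k) : Mono (gatedι P V) :=
  ConcreteCategory.mono_of_injective _ (Subtype.val_injective)

@[simp]
lemma gatedMap_ι {P P' : Prop} {V V' : FGModuleCat.{u} k} (f : V ⟶ V') (h : P → P') :
    gatedMap f h ≫ gatedι P' V' = gatedι P V ≫ f := rfl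

lemma gated_hom_ext {P : Prop} {V X : FGModuleCat.{u} k} {f g : X ⟶ gated P V}
    (h : f ≫ gatedι P V = g ≫ gatedι P V) : f = g :=
  (cancel_mono _).1 h

lemma isIso_gatedι {P : Prop} (hP : P) (V : FGModuleCat.{u} k) : IsIso (gatedι P V) := by
  refine ⟨FGModuleCat.ofHom (LinearMap.codRestrict (gate P V) LinearMap.id
    (fun x _ ↦ hP)), ?_, ?_⟩
  · rfl
  · rfl

lemma isIso_gatedMap {P P' : Prop} (hP : P) (hP' : P') {V V' : FGModuleCat.{u} k} (f : V ⟶ V')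
    [IsIso f] : IsIso (gatedMap f (fun _ : P ↦ hP')) := by
  have := isIso_gatedι hP V
  have := isIso_gatedι hP' V'
  have : IsIso (gatedMap f (fun _ : P ↦ hP') ≫ gatedι P' V') := by
    rw [gatedMap_ι]
    infer_instance
  exact IsIso.of_isIso_comp_right _ (gatedι P' V')

lemma isZero_gated {P : Prop} (hP : ¬ P) (V : FGModuleCat.{u} k) : IsZero (gated P V) := by
  rw [IsZero.iff_id_eq_zero, ← cancel_mono (gatedι P V)]
  ext x
  exact eq_zero_of_mem_gate x.2 hP

variable (k) in
/-- The functor sending `V` to the representation that is `V` at the vertex `v`, zero at the other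
vertices, and zero on arrows. -/
def skyscraper (v : Q) : FGModuleCat.{u} k ⥤ Rep k Q where
  obj V := Rep.mk (fun w ↦ gated (w = v) V) (fun _ ↦ 0)
  map f := Rep.homMk (fun w ↦ gatedMap f id) (fun α ↦ by
    rw [Rep.mk_map, Rep.mk_map]
    exact zero_comp.trans comp_zero.symm)

instance (v : Q) : (skyscraper k v).Additive where
  map_add {V W f g} := by
    refine Rep.hom_ext' (fun w ↦ gated_hom_ext (P := w = v) (V := W) ?_)
    rfl

lemma skyscraper_map_arrow (v : Q) (V : FGModuleCat.{u} k) {a b : Q} (α : a ⟶ b) :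
    ((skyscraper k v).obj V).map ((Paths.of Q).map α) = 0 :=
  Rep.mk_map _ _ _

lemma isZero_ev_skyscraper {v w : Q} (h : w ≠ v) (V : FGModuleCat.{u} k) :
    IsZero ((ev k w).obj ((skyscraper k v).obj V)) :=
  isZero_gated h V

/-- The value at `v` of the representation `V` placed at `v` is `V`. -/
def evSkyscraperIso (v : Q) : skyscraper k v ⋙ ev k v ≅ 𝟭 (FGModuleCat.{u} k) :=
  NatIso.ofComponents (fun V ↦ @asIso _ _ _ _ (gatedι (v = v) V) (isIso_gatedι rfl V))
    (fun _ ↦ rfl)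

variable (k) in
/-- The functor sending `M` to its subrepresentation supported at the vertices that can be reached
from `v`. -/
def reachable (v : Q) : Rep k Q ⥤ Rep k Q where
  obj M := Rep.mk (fun w ↦ gated (Nonempty (Quiver.Path v w)) ((ev k w).obj M))
    (fun {a b} α ↦ gatedMap (M.map ((Paths.of Q).map α)) (fun ⟨p⟩ ↦ ⟨p.cons α⟩))
  map f := Rep.homMk (fun w ↦ gatedMap (f.app w) id) (fun {a b} α ↦ by
    rw [Rep.mk_map, Rep.mk_map]
    refine gated_hom_ext (V := (ev k b).obj _) ?_
    exact congrArg (gatedι _ _ ≫ ·) (f.naturality ((Paths.of Q).map α)))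

instance (v : Q) : (reachable k v).Additive where
  map_add {V W f g} := by
    refine Rep.hom_ext' (fun w ↦ gated_hom_ext (V := (ev k w).obj W) ?_)
    rfl

variable (k) in
/-- The inclusion of the subrepresentation `reachable`. -/
def reachableι (v : Q) : reachable k v ⟶ 𝟭 (Rep k Q) where
  app M := Rep.homMk (fun w ↦ gatedι _ _) (fun {a b} α ↦ by
    erw [Rep.mk_map]
    rfl)
  naturality M N f := Rep.hom_ext' (fun w ↦ rfl)

lemma isIso_ev_reachableι {v w : Q} (h : Nonempty (Quiver.Path v w)) (M : Rep k Q) :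
    IsIso ((ev k w).map ((reachableι k v).app M)) :=
  isIso_gatedι h ((ev k w).obj M)

lemma isZero_ev_reachable {v w : Q} (h : ¬ Nonempty (Quiver.Path v w)) (M : Rep k Q) :
    IsZero ((ev k w).obj ((reachable k v).obj M)) :=
  isZero_gated h ((ev k w).obj M)

/-- The component at the vertex `w` of `reachableToSkyscraper`. -/
def reachableToSkyscraperApp (v w : Q) (M : Rep k Q) :
    (ev k w).obj ((reachable k v).obj M) ⟶
      (ev k w).obj ((skyscraper k v).obj ((ev k v).obj M)) := by
  classical
  exact if h : w = v then by
    subst h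
    exact gatedMap (V := (ev k w).obj M) (V' := (ev k w).obj M) (𝟙 _) (fun _ ↦ rfl) else 0

lemma reachableToSkyscraperApp_self (v : Q) (M : Rep k Q) :
    reachableToSkyscraperApp v v M =
      gatedMap (V := (ev k v).obj M) (V' := (ev k v).obj M) (𝟙 _) (fun _ ↦ rfl) := by
  exact dif_pos rfl

variable (k) in
/-- In an acyclic quiver no arrow leads back to `v` from a vertex that can be reached from `v`, so
the part at `v` is a quotient of the subrepresentation `reachable`. -/
def reachableToSkyscraper (hQ : IsFiniteAcyclic Q) (v : Q) :
    reachable k v ⟶ ev k v ⋙ skyscraper k v where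
  app M := Rep.homMk (fun w ↦ reachableToSkyscraperApp v w M) (fun {a b} α ↦ by
    by_cases hb : b = v
    · subst hb
      -- If `a` could be reached from `b`, the arrow `α : a ⟶ b` would close an oriented cycle.
      refine (isZero_ev_reachable (fun ⟨p⟩ ↦ ?_) M).eq_of_src _ _
      simpa using congrArg Quiver.Path.length (hQ.acyclic _ (p.cons α))
    · exact (isZero_ev_skyscraper hb _).eq_of_tgt _ _)
  naturality M N f := Rep.hom_ext' (fun w ↦ by
    by_cases hw : w = v
    · subst hw
      change gatedMap (V := (ev k w).obj M) (V' := (ev k w).obj N) (f.app w) id ≫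
        reachableToSkyscraperApp w w N = reachableToSkyscraperApp w w M ≫
          gatedMap (V := (ev k w).obj M) (V' := (ev k w).obj N) (f.app w) id
      rw [reachableToSkyscraperApp_self, reachableToSkyscraperApp_self]
      rfl
    · exact (isZero_ev_skyscraper hw _).eq_of_tgt _ _)

lemma isIso_ev_reachableToSkyscraper (hQ : IsFiniteAcyclic Q) (v : Q) (M : Rep k Q) :
    IsIso ((ev k v).map ((reachableToSkyscraper k hQ v).app M)) := by
  change IsIso (reachableToSkyscraperApp v v M)
  rw [reachableToSkyscraperApp_self]
  exact isIso_gatedMap ⟨.nil⟩ rfl (V := (ev k v).obj M) (V' := (ev k v).obj M) (𝟙 _)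

variable (k) in
/-- The simple representation at the vertex `v`. -/
def simpleAt (v : Q) : Rep k Q := (skyscraper k v).obj (FGModuleCat.of k k)

end Representations

/-! ### Objects of the derived category with cohomology at one vertex -/

section Split

variable {k : Type u} [Field k]

/-- A nonzero cohomology class of vector spaces is split off by a linear form that vanishes on the
boundaries. -/
lemma exists_cocycle (S : ShortComplex (FGModuleCat.{u} k)) (hS : ¬ S.Exact) :
    ∃ (f : FGModuleCat.of k k ⟶ S.X₂) (g : S.X₂ ⟶ FGModuleCat.of k k),
      f ≫ S.g = 0 ∧ S.f ≫ g = 0 ∧ f ≫ g = 𝟙 _ := by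
  rw [← S.exact_map_iff_of_faithful (forget₂ (FGModuleCat.{u} k) (ModuleCat.{u} k)),
    ShortComplex.moduleCat_exact_iff] at hS
  push Not at hS
  obtain ⟨x, hx, hx'⟩ := hS
  obtain ⟨φ, hφ, hφ'⟩ := Submodule.exists_le_ker_of_notMem
    (p := LinearMap.range S.f.hom.hom) (v := x) (by rintro ⟨y, hy⟩; exact hx' y hy)
  refine ⟨ObjectProperty.homMk (ModuleCat.ofHom (LinearMap.toSpanSingleton k _ x)),
    ObjectProperty.homMk (ModuleCat.ofHom ((φ x)⁻¹ • φ)), ?_, ?_, ?_⟩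
  · ext
    refine (map_smul S.g.hom.hom (1 : k) x).trans ?_
    exact (one_smul _ _).trans hx
  · ext y
    have : φ (S.f.hom.hom y) = 0 := hφ' ⟨y, rfl⟩
    change (φ x)⁻¹ • φ (S.f.hom.hom y) = 0
    rw [this, smul_zero]
  · ext
    change (φ x)⁻¹ • φ ((1 : k) • x) = 1
    rw [one_smul, smul_eq_mul, inv_mul_cancel₀ hφ]

/-- A complex of vector spaces with cohomology in degree `m` has the field in degree `m` as a direct
factor. -/
lemma exists_retract_single (K : CochainComplex (FGModuleCat.{u} k) ℤ) (m : ℤ)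
    (h : ¬ K.ExactAt m) :
    Nonempty (Retract ((HomologicalComplex.single _ _ m).obj (FGModuleCat.of k k)) K) := by
  obtain ⟨f, g, hf, hg, hfg⟩ : ∃ (f : FGModuleCat.of k k ⟶ K.X m) (g : K.X m ⟶ FGModuleCat.of k k),
      f ≫ (K.sc m).g = 0 ∧ (K.sc m).f ≫ g = 0 ∧ f ≫ g = 𝟙 _ := exists_cocycle (K.sc m) h
  refine ⟨⟨HomologicalComplex.mkHomFromSingle f (fun i hi ↦ ?_),
    HomologicalComplex.mkHomToSingle g (fun i hi ↦ ?_), ?_⟩⟩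
  · obtain rfl := (ComplexShape.up ℤ).next_eq' hi
    exact hf
  · obtain rfl := (ComplexShape.up ℤ).prev_eq' hi
    exact hg
  · apply HomologicalComplex.from_single_hom_ext
    rw [HomologicalComplex.comp_f, HomologicalComplex.mkHomFromSingle_f,
      HomologicalComplex.mkHomToSingle_f, HomologicalComplex.id_f, Category.assoc,
      reassoc_of% hfg, Iso.hom_inv_id]

end Split

section Support

variable (k : Type u) [Field k] {Q : Type w} [Quiver.{v} Q]

/-- The cohomology in degree `n` at the vertex `v`. -/
abbrev cohomologyAt (n : ℤ) (v : Q) : DerivedCategory (Rep k Q) ⥤ FGModuleCat.{u} k :=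
  DerivedCategory.homologyFunctor _ n ⋙ ev k v

variable {k}

lemma isZero_cohomologyAt_iff (K : CochainComplex (Rep k Q) ℤ) (n : ℤ) (v : Q) :
    IsZero ((cohomologyAt k n v).obj (DerivedCategory.Q.obj K)) ↔
      ((mapC (ev k v)).obj K).ExactAt n := by
  have e₁ : (cohomologyAt k n v).obj (DerivedCategory.Q.obj K) ≅ (ev k v).obj (K.homology n) :=
    (ev k v).mapIso ((DerivedCategory.homologyFunctorFactors (Rep k Q) n).app K)
  have e₂ : ((K.sc n).map (ev k v)).homology ≅ (ev k v).obj (K.homology n) :=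
    (K.sc n).mapHomologyIso (ev k v)
  rw [e₁.isZero_iff, ← e₂.isZero_iff]
  exact (ShortComplex.exact_iff_isZero_homology _).symm

lemma quasiIso_of_acyclic {C : Type*} [Category* C] [Abelian C] {K L : CochainComplex C ℤ}
    (f : K ⟶ L) (hK : K.Acyclic) (hL : L.Acyclic) : QuasiIso f where
  quasiIsoAt i := (quasiIsoAt_iff_exactAt f i (hK i)).2 (hL i)

lemma acyclic_of_isZero {C : Type*} [Category* C] [Abelian C] {K : CochainComplex C ℤ}
    (h : ∀ i, IsZero (K.X i)) : K.Acyclic := fun i ↦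
  ShortComplex.exact_of_isZero_X₂ _ (h i)

/-- An object with cohomology only at the vertex `v` has a shift of the simple representation as a
direct factor wherever its cohomology does not vanish. The object is compared with the complex of
its values at `v`, through the subrepresentations `reachable`. -/
lemma exists_retract_of_support (hQ : IsFiniteAcyclic Q) (v : Q) (m : ℤ)
    (X : DerivedCategory (Rep k Q))
    (hX : ∀ u ≠ v, ∀ n, IsZero ((cohomologyAt k n u).obj X))
    (hm : ¬ IsZero ((cohomologyAt k m v).obj X)) :
    Nonempty (Retract (DerivedCategory.Q.obj
      ((HomologicalComplex.single (Rep k Q) (.up ℤ) m).obj (simpleAt k v))) X) := by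
  obtain ⟨K, ⟨e⟩⟩ : ∃ K, Nonempty (DerivedCategory.Q.obj K ≅ X) :=
    ⟨_, ⟨DerivedCategory.Q.objObjPreimageIso X⟩⟩
  have hK (u) (hu : u ≠ v) : ((mapC (ev k u)).obj K).Acyclic := fun n ↦
    (isZero_cohomologyAt_iff K n u).1 (((cohomologyAt k n u).mapIso e).isZero_iff.2 (hX u hu n))
  let f := (NatTrans.mapHomologicalComplex (reachableι k v) (.up ℤ)).app K
  let g := (NatTrans.mapHomologicalComplex (reachableToSkyscraper k hQ v) (.up ℤ)).app K
  have hJ (u) (hu : u ≠ v) : ((mapC (ev k u)).obj ((mapC (reachable k v)).obj K)).Acyclic := by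
    by_cases h : Nonempty (Quiver.Path v u)
    · have : ∀ i, IsIso (((mapC (ev k u)).map f).f i) := fun i ↦ isIso_ev_reachableι h (K.X i)
      have := HomologicalComplex.Hom.isIso_of_components ((mapC (ev k u)).map f)
      exact fun i ↦ (hK u hu i).of_iso (asIso ((mapC (ev k u)).map f)).symm
    · exact acyclic_of_isZero (fun i ↦ isZero_ev_reachable h (K.X i))
  have hf : QuasiIso f := (quasiIso_iff_ev k Q f).2 (fun u ↦ by
    by_cases hu : u = v
    · have : ∀ i, IsIso (((mapC (ev k u)).map f).f i) := fun i ↦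
        isIso_ev_reachableι (by rw [hu]; exact ⟨.nil⟩) (K.X i)
      have := HomologicalComplex.Hom.isIso_of_components ((mapC (ev k u)).map f)
      infer_instance
    · exact quasiIso_of_acyclic _ (hJ u hu) (hK u hu))
  have hg : QuasiIso g := (quasiIso_iff_ev k Q g).2 (fun u ↦ by
    by_cases hu : u = v
    · subst hu
      have : ∀ i, IsIso (((mapC (ev k u)).map g).f i) := fun i ↦
        isIso_ev_reachableToSkyscraper hQ u (K.X i)
      have := HomologicalComplex.Hom.isIso_of_components ((mapC (ev k u)).map g)
      infer_instance
    · exact quasiIso_of_acyclic _ (hJ u hu)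
        (acyclic_of_isZero (fun i ↦ isZero_ev_skyscraper hu _)))
  obtain ⟨r⟩ := exists_retract_single ((mapC (ev k v)).obj K) m (fun h ↦ hm
    (((cohomologyAt k m v).mapIso e).isZero_iff.1 ((isZero_cohomologyAt_iff K m v).2 h)))
  let e' : DerivedCategory.Q.obj ((mapC (skyscraper k v)).obj ((mapC (ev k v)).obj K)) ≅ X :=
    (asIso (DerivedCategory.Q.map g)).symm ≪≫ asIso (DerivedCategory.Q.map f) ≪≫ e
  exact ⟨(Retract.ofIso (DerivedCategory.Q.mapIso
    ((HomologicalComplex.singleMapHomologicalComplex (skyscraper k v) (.up ℤ) m).app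
      (FGModuleCat.of k k)).symm)).trans
        (((r.map (mapC (skyscraper k v))).map DerivedCategory.Q).trans (Retract.ofIso e'))⟩

end Support

/-! ### Tensor products with simple representations -/

section Tensor

lemma isZero_tensorObj_X {C : Type*} [Category* C] [MonoidalCategory C] [Preadditive C]
    [MonoidalPreadditive C] [HasZeroObject C] [HasFiniteCoproducts C] (K L : CochainComplex C ℤ)
    [FinSupp K.X] [FinSupp L.X] (n : ℤ)
    (h : ∀ i j, i + j = n → IsZero (K.X i ⊗ L.X j)) :
    IsZero ((HomologicalComplex.tensorObj K L).X n) := by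
  rw [IsZero.iff_id_eq_zero]
  exact HomologicalComplex.mapBifunctor.hom_ext (fun i j hij ↦ (h i j hij).eq_of_src _ _)

instance finSupp_single_obj {C : Type*} [Category* C] [HasZeroMorphisms C] [HasZeroObject C]
    (n : ℤ) (X : C) : FinSupp ((HomologicalComplex.single C (.up ℤ) n).obj X).X :=
  ⟨{n}, Set.finite_singleton _, fun _ hi ↦
    HomologicalComplex.isZero_single_obj_X (.up ℤ) n X _ hi⟩

lemma bounded_single {C : Type*} [Category* C] [HasZeroMorphisms C] [HasZeroObject C] (n : ℤ)
    (X : C) : bounded C ((HomologicalComplex.single C (.up ℤ) n).obj X) :=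
  bounded_of_finSupp _

variable {k : Type u} [Field k] {Q : Type w} [Quiver.{v} Q]

variable (k) in
/-- The cohomology in degree `n` at the vertex `v`, on the bounded derived category. -/
abbrev cohomologyAtb (n : ℤ) (v : Q) : Db k Q ⥤ FGModuleCat.{u} k :=
  DerivedCategory.Bounded.ι ⋙ cohomologyAt k n v

variable (k) in
/-- The simple representation at the vertex `v`, placed in degree `m`. -/
def simpleb (v : Q) (m : ℤ) : Db k Q :=
  (Qb (Rep k Q)).obj ⟨(HomologicalComplex.single (Rep k Q) (.up ℤ) m).obj (simpleAt k v),
    bounded_single _ _⟩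

lemma exists_cohomologyAtb_ne_zero {X : Db k Q} (hX : ¬ IsZero X) :
    ∃ (v : Q) (n : ℤ), ¬ IsZero ((cohomologyAtb k n v).obj X) := by
  by_contra! h
  refine hX ?_
  have h' (n : ℤ) : IsZero ((DerivedCategory.homologyFunctor (Rep k Q) n).obj X.obj) := by
    rw [IsZero.iff_id_eq_zero]
    exact Rep.hom_ext' (fun v ↦ (h v n).eq_of_src _ _)
  have : IsIso (0 : X.obj ⟶ X.obj) := (DerivedCategory.isIso_iff _ _).2 (fun n ↦
    ⟨0, (h' n).eq_of_src _ _, (h' n).eq_of_src _ _⟩)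
  rw [IsZero.iff_id_eq_zero]
  refine ObjectProperty.hom_ext _ ?_
  exact ((IsIso.hom_inv_id (0 : X.obj ⟶ X.obj)).symm.trans zero_comp)

/-- The evaluation at a vertex is monoidal, so the cohomology of a tensor product at a vertex is
that of a tensor product of complexes of vector spaces. -/
lemma isZero_cohomologyAtb_tensor_iff (K L : Compb (Rep k Q)) (n : ℤ) (v : Q) :
    IsZero ((cohomologyAtb k n v).obj ((Qb _).obj K ⊗ (Qb _).obj L)) ↔
      (HomologicalComplex.tensorObj ((mapC (ev k v)).obj K.obj)
        ((mapC (ev k v)).obj L.obj)).ExactAt n := by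
  rw [((cohomologyAtb k n v).mapIso (Functor.Monoidal.μIso (Qb (Rep k Q)) K L)).isZero_iff]
  refine (isZero_cohomologyAt_iff _ n v).trans ?_
  let e : HomologicalComplex.tensorObj ((mapC (ev k v)).obj K.obj) ((mapC (ev k v)).obj L.obj) ≅
    (mapC (ev k v)).obj (K ⊗ L).obj := asIso (mapTensor (ev k v) K.obj L.obj)
  exact ⟨fun h ↦ h.of_iso e.symm, fun h ↦ h.of_iso e⟩

lemma Qb_surj (X : Db k Q) : ∃ K, Nonempty ((Qb _).obj K ≅ X) :=
  have := Localization.essSurj (Qb (Rep k Q)) (quasiIsob (Rep k Q))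
  ⟨_, ⟨(Qb _).objObjPreimageIso X⟩⟩

lemma isZero_X_simpleb (v u : Q) (m i : ℤ) (h : u ≠ v ∨ i ≠ m) :
    IsZero (((mapC (ev k u)).obj
      ((HomologicalComplex.single (Rep k Q) (.up ℤ) m).obj (simpleAt k v))).X i) := by
  by_cases hi : i = m
  · subst hi
    exact IsZero.of_iso (isZero_ev_skyscraper (by simpa using h) (FGModuleCat.of k k))
      ((ev k u).mapIso (HomologicalComplex.singleObjXSelf (.up ℤ) i (simpleAt k v)))
  · exact (ev k u).map_isZero (HomologicalComplex.isZero_single_obj_X (.up ℤ) m _ _ hi)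

lemma isZero_cohomologyAtb_simpleb (v u : Q) (m n : ℤ) (h : u ≠ v ∨ n ≠ m) :
    IsZero ((cohomologyAtb k n u).obj (simpleb k v m)) :=
  (isZero_cohomologyAt_iff _ n u).2
    (ShortComplex.exact_of_isZero_X₂ _ (isZero_X_simpleb v u m n h))

lemma isZero_cohomologyAtb_tensor_simpleb (X : Db k Q) (v u : Q) (h : u ≠ v) (n : ℤ) :
    IsZero ((cohomologyAtb k n u).obj (X ⊗ simpleb k v 0)) := by
  obtain ⟨K, ⟨e⟩⟩ := Qb_surj X
  rw [← ((cohomologyAtb k n u).mapIso (whiskerRightIso e (simpleb k v 0))).isZero_iff]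
  refine (isZero_cohomologyAtb_tensor_iff _ _ _ _).2 (ShortComplex.exact_of_isZero_X₂ _ ?_)
  exact isZero_tensorObj_X ((mapC _).obj _)
    ((mapC _).obj ((HomologicalComplex.single _ _ _).obj _)) _ (fun i j _ ↦
    isZero_tensor_right (isZero_X_simpleb v u 0 j (.inl h)) _)

lemma isZero_cohomologyAtb_simpleb_tensor (X : Db k Q) (v u : Q) (h : u ≠ v) (n : ℤ) :
    IsZero ((cohomologyAtb k n u).obj (simpleb k v 0 ⊗ X)) := by
  obtain ⟨K, ⟨e⟩⟩ := Qb_surj X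
  rw [← ((cohomologyAtb k n u).mapIso (whiskerLeftIso (simpleb k v 0) e)).isZero_iff]
  refine (isZero_cohomologyAtb_tensor_iff _ _ _ _).2 (ShortComplex.exact_of_isZero_X₂ _ ?_)
  exact isZero_tensorObj_X ((mapC _).obj ((HomologicalComplex.single _ _ _).obj _))
    ((mapC _).obj _) _ (fun i j _ ↦ isZero_tensor_left (isZero_X_simpleb v u 0 i (.inl h)) _)

/-- The tensor square of a simple representation in degree `m` is concentrated in degree `2 * m`,
which is not `m` unless `m = 0`. -/
lemma isZero_cohomologyAtb_simpleb_tensor_self (v : Q) (m : ℤ) (h : m ≠ 0) :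
    IsZero ((cohomologyAtb k m v).obj (simpleb k v m ⊗ simpleb k v m)) := by
  refine (isZero_cohomologyAtb_tensor_iff _ _ _ _).2 (ShortComplex.exact_of_isZero_X₂ _ ?_)
  refine isZero_tensorObj_X ((mapC _).obj ((HomologicalComplex.single _ _ _).obj _))
    ((mapC _).obj ((HomologicalComplex.single _ _ _).obj _)) _ (fun i j hij ↦ ?_)
  by_cases hi : i = m
  · exact isZero_tensor_right (isZero_X_simpleb v v m j (.inr (by lia))) _
  · exact isZero_tensor_left (isZero_X_simpleb v v m i (.inr hi)) _

/-- The complex `simpleb k v 0` becomes the tensor unit at the vertex `v`. -/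
def evSimplebIso (v : Q) : (mapC (ev k v)).obj
    ((HomologicalComplex.single (Rep k Q) (.up ℤ) 0).obj (simpleAt k v)) ≅
      HomologicalComplex.tensorUnit (FGModuleCat.{u} k) (.up ℤ) :=
  (HomologicalComplex.singleMapHomologicalComplex (ev k v) (.up ℤ) 0).app _ ≪≫
    (HomologicalComplex.single (FGModuleCat.{u} k) (.up ℤ) 0).mapIso
      ((evSkyscraperIso v).app (FGModuleCat.of k k))

/-- The tensor product with the simple representation at `v` does not change the cohomology at `v`.
-/
lemma isZero_cohomologyAtb_tensor_simpleb_iff (X : Db k Q) (v : Q) (n : ℤ) :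
    IsZero ((cohomologyAtb k n v).obj (X ⊗ simpleb k v 0)) ↔
      IsZero ((cohomologyAtb k n v).obj X) := by
  obtain ⟨K, ⟨e⟩⟩ := Qb_surj X
  rw [← ((cohomologyAtb k n v).mapIso (whiskerRightIso e (simpleb k v 0))).isZero_iff,
    ← ((cohomologyAtb k n v).mapIso e).isZero_iff]
  refine (isZero_cohomologyAtb_tensor_iff _ _ _ _).trans
    (.trans ?_ (isZero_cohomologyAt_iff _ n v).symm)
  let K' : Compb (FGModuleCat.{u} k) := ⟨(mapC (ev k v)).obj K.obj, bounded_of_finSupp _⟩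
  let L' : Compb (FGModuleCat.{u} k) := ⟨(mapC (ev k v)).obj
    ((HomologicalComplex.single (Rep k Q) (.up ℤ) 0).obj (simpleAt k v)),
      bounded_of_finSupp _⟩
  let e₀ : L' ≅ 𝟙_ _ := ObjectProperty.isoMk _ (evSimplebIso v)
  let e' : (K' ⊗ L').obj ≅ K'.obj := (bounded _).ι.mapIso (whiskerLeftIso K' e₀ ≪≫ ρ_ K')
  exact ⟨fun h ↦ h.of_iso e', fun h ↦ h.of_iso e'.symm⟩

lemma not_isZero_cohomologyAtb_simpleb (v : Q) (m : ℤ) :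
    ¬ IsZero ((cohomologyAtb k m v).obj (simpleb k v m)) := by
  intro h
  have e := (ev k v).mapIso ((DerivedCategory.homologyFunctorFactors (Rep k Q) m).app
    ((HomologicalComplex.single (Rep k Q) (.up ℤ) m).obj (simpleAt k v)) ≪≫
      (HomologicalComplex.homologyFunctorSingleIso (Rep k Q) (.up ℤ) m).app (simpleAt k v)) ≪≫
    (evSkyscraperIso v).app (FGModuleCat.of k k)
  have h' : IsZero (FGModuleCat.of k k) := e.isZero_iff.1 h
  have := ObjectProperty.hom_ext_iff.1 (h'.eq_of_src (𝟙 _) 0)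
  exact one_ne_zero (α := k) (LinearMap.congr_fun (ModuleCat.hom_ext_iff.1 this) (1 : k))

end Tensor

/-! ### Monoidal equivalences permute the simple representations -/

section Simple

variable {k : Type u} [Field k] {Q : Type w} [Quiver.{v} Q]

lemma not_isZero_simpleb (v : Q) (m : ℤ) : ¬ IsZero (simpleb k v m) := fun h ↦
  not_isZero_cohomologyAtb_simpleb v m ((cohomologyAtb k m v).map_isZero h)

variable (k) in
/-- Comparison of `simpleb` with the embedding of the abelian category in degree `m`. -/
def simplebIso (v : Q) (m : ℤ) :
    (simpleb k v m).obj ≅ (DerivedCategory.singleFunctor (Rep k Q) m).obj (simpleAt k v) :=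
  ((DerivedCategory.singleFunctorIsoCompQ (Rep k Q) m).app (simpleAt k v)).symm

/-- The shift by `n` lowers the degree by `n`. -/
def simplebShiftIso (v : Q) (m n m' : ℤ) (h : n + m' = m) :
    (simpleb k v m)⟦n⟧ ≅ simpleb k v m' :=
  DerivedCategory.Bounded.ι.preimageIso
    ((DerivedCategory.Bounded.ι.commShiftIso n).app _ ≪≫
      (shiftFunctor (DerivedCategory (Rep k Q)) n).mapIso (simplebIso k v m) ≪≫
      ((DerivedCategory.singleFunctors (Rep k Q)).shiftIso n m' m h).app (simpleAt k v) ≪≫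
      (simplebIso k v m').symm)

/-- An object whose idempotent endomorphisms are trivial. -/
def TrivialIdempotents {C : Type*} [Category* C] [HasZeroMorphisms C] (X : C) : Prop :=
  ∀ f : X ⟶ X, f ≫ f = f → f = 0 ∨ f = 𝟙 X

lemma TrivialIdempotents.map {C D : Type*} [Category* C] [Category* D] [HasZeroMorphisms C]
    [HasZeroMorphisms D] {X : C} (hX : TrivialIdempotents X) (F : C ⥤ D)
    [F.Full] [F.Faithful] [F.PreservesZeroMorphisms] : TrivialIdempotents (F.obj X) := by
  intro f hf
  obtain ⟨f, rfl⟩ := F.map_surjective f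
  rw [← F.map_comp] at hf
  rcases hX f (F.map_injective hf) with rfl | rfl
  · simp
  · simp

lemma TrivialIdempotents.of_map {C D : Type*} [Category* C] [Category* D] [HasZeroMorphisms C]
    [HasZeroMorphisms D] {X : C} (F : C ⥤ D) (hX : TrivialIdempotents (F.obj X))
    [F.Faithful] [F.PreservesZeroMorphisms] : TrivialIdempotents X := by
  intro f hf
  rcases hX (F.map f) (by rw [← F.map_comp, hf]) with h | h
  · exact .inl (F.map_injective (by simpa using h))
  · exact .inr (F.map_injective (by simpa using h))

lemma TrivialIdempotents.of_iso {C : Type*} [Category* C] [HasZeroMorphisms C] {X Y : C}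
    (hX : TrivialIdempotents X) (e : X ≅ Y) : TrivialIdempotents Y := by
  intro f hf
  rcases hX (e.hom ≫ f ≫ e.inv) (by simp [reassoc_of% hf]) with h | h
  · exact .inl (by simpa using congrArg (fun g ↦ e.inv ≫ g ≫ e.hom) h)
  · exact .inr (by simpa using congrArg (fun g ↦ e.inv ≫ g ≫ e.hom) h)

lemma TrivialIdempotents.nonempty_iso_of_retract {C : Type*} [Category* C] [HasZeroMorphisms C]
    {X Y : C} (hX : TrivialIdempotents X) (r : Retract Y X) (hY : ¬ IsZero Y) :
    Nonempty (Y ≅ X) := by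
  have h : r.i ≫ r.r = 𝟙 _ := r.retract
  rcases hX (r.r ≫ r.i) (by rw [Category.assoc, reassoc_of% h]) with h' | h'
  · refine (hY ((IsZero.iff_id_eq_zero _).2 ?_)).elim
    calc 𝟙 Y = r.i ≫ (r.r ≫ r.i) ≫ r.r := by simp only [Category.assoc, reassoc_of% h, h]
      _ = 0 := by simp [h']
  · exact ⟨⟨r.i, r.r, h, h'⟩⟩

lemma trivialIdempotents_unit : TrivialIdempotents (FGModuleCat.of k k) := by
  intro g hg
  have h₁ : g.hom.hom (g.hom.hom (1 : k)) = g.hom.hom (1 : k) :=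
    LinearMap.congr_fun (ModuleCat.hom_ext_iff.1 (ObjectProperty.hom_ext_iff.1 hg)) (1 : k)
  have h₂ (c : k) : g.hom.hom c = c * g.hom.hom (1 : k) := by
    have := map_smul g.hom.hom c (1 : k)
    rwa [smul_eq_mul, mul_one] at this
  rw [h₂] at h₁
  rcases IsIdempotentElem.iff_eq_zero_or_one.1 h₁ with h | h
  · left
    ext
    exact h
  · right
    ext
    exact h

lemma trivialIdempotents_simpleAt (v : Q) : TrivialIdempotents (simpleAt k v) := by
  intro f hf
  have ext (f g : simpleAt k v ⟶ simpleAt k v) (h : (ev k v).map f = (ev k v).map g) : f = g :=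
    Rep.hom_ext' (fun w ↦ by
      by_cases hw : w = v
      · subst hw
        exact h
      · exact (isZero_ev_skyscraper hw _).eq_of_src _ _)
  have h : TrivialIdempotents ((ev k v).obj (simpleAt k v)) :=
    trivialIdempotents_unit.of_iso ((evSkyscraperIso v).app (FGModuleCat.of k k)).symm
  rcases h ((ev k v).map f) (by rw [← Functor.map_comp, hf]) with h | h
  · exact .inl (ext _ _ h)
  · exact .inr (ext _ _ h)

lemma trivialIdempotents_simpleb (v : Q) (m : ℤ) : TrivialIdempotents (simpleb k v m) :=
  .of_map DerivedCategory.Bounded.ι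
    (((trivialIdempotents_simpleAt v).map (DerivedCategory.singleFunctor _ m)).of_iso
      (simplebIso k v m).symm)

lemma nonempty_retract_simpleb (hQ : IsFiniteAcyclic Q) (v : Q) (m : ℤ) (X : Db k Q)
    (hX : ∀ u ≠ v, ∀ n, IsZero ((cohomologyAtb k n u).obj X))
    (hm : ¬ IsZero ((cohomologyAtb k m v).obj X)) : Nonempty (Retract (simpleb k v m) X) := by
  obtain ⟨r⟩ := exists_retract_of_support hQ v m X.obj hX hm
  exact ⟨⟨ObjectProperty.homMk r.i, ObjectProperty.homMk r.r,
    ObjectProperty.hom_ext _ r.retract⟩⟩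

lemma isZero_of_retract {C : Type*} [Category* C] [HasZeroMorphisms C] {X Y : C}
    (r : Retract X Y) (h : IsZero Y) : IsZero X :=
  (IsZero.iff_id_eq_zero _).2 (by rw [← r.retract, h.eq_of_tgt r.i 0, zero_comp])

/-- An object with cohomology only at `v` and without nontrivial idempotents is a shift of the
simple representation at `v`, since such a shift is a direct factor of it. -/
lemma exists_iso_simpleb (hQ : IsFiniteAcyclic Q) (v : Q) (X : Db k Q)
    (hX : ∀ u ≠ v, ∀ n, IsZero ((cohomologyAtb k n u).obj X))
    (hX₀ : ¬ IsZero X) (hX' : TrivialIdempotents X) :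
    ∃ m, Nonempty (simpleb k v m ≅ X) := by
  obtain ⟨u, m, hm⟩ := exists_cohomologyAtb_ne_zero hX₀
  obtain rfl : u = v := by
    by_contra hu
    exact hm (hX u hu m)
  obtain ⟨r⟩ := nonempty_retract_simpleb hQ u m X hX hm
  exact ⟨m, hX'.nonempty_iso_of_retract r (not_isZero_simpleb _ _)⟩

lemma eq_of_iso_simpleb {v v' : Q} {m m' : ℤ} (e : simpleb k v m ≅ simpleb k v' m') : v = v' := by
  by_contra h
  exact not_isZero_cohomologyAtb_simpleb v m
    (((cohomologyAtb k m v).mapIso e).isZero_iff.2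
      (isZero_cohomologyAtb_simpleb v' v m' m (.inl h)))

lemma exists_tensor_simpleb_ne_zero {X : Db k Q} (hX : ¬ IsZero X) :
    ∃ v : Q, ¬ IsZero (X ⊗ simpleb k v 0) := by
  obtain ⟨v, n, h⟩ := exists_cohomologyAtb_ne_zero hX
  exact ⟨v, fun h' ↦ h ((isZero_cohomologyAtb_tensor_simpleb_iff X v n).1
    ((cohomologyAtb k n v).map_isZero h'))⟩

/-- The simple representation in degree zero is a direct factor of its tensor square. -/
lemma nonempty_retract_simpleb_tensor_self (hQ : IsFiniteAcyclic Q) (v : Q) :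
    Nonempty (Retract (simpleb k v 0) (simpleb k v 0 ⊗ simpleb k v 0)) :=
  nonempty_retract_simpleb hQ v 0 _ (fun u hu n ↦ isZero_cohomologyAtb_tensor_simpleb _ v u hu n)
    (fun h ↦ not_isZero_cohomologyAtb_simpleb v 0
      ((isZero_cohomologyAtb_tensor_simpleb_iff _ v 0).1 h))

end Simple

section Equivalence

variable {k : Type u} [Field k] {Q : Type w} [Quiver.{v} Q] {Q' : Type w'} [Quiver.{v'} Q']
  (hQ : IsFiniteAcyclic Q) (hQ' : IsFiniteAcyclic Q')
  (F : Db k Q ⥤ Db k Q') [F.IsEquivalence] [F.Additive] [F.Monoidal] [F.CommShift ℤ]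

include hQ hQ'

/-- A monoidal equivalence sends simple representations to shifts of simple representations. -/
lemma exists_map_simpleb_iso_shift (a : Q) :
    ∃ (v : Q') (p : ℤ), Nonempty (F.obj (simpleb k a 0) ≅ simpleb k v p) := by
  have hF : ¬ IsZero (F.obj (simpleb k a 0)) := fun h ↦ not_isZero_simpleb a 0
    ((IsZero.iff_id_eq_zero _).2 (F.map_injective (h.eq_of_src _ _)))
  obtain ⟨v, hv⟩ := exists_tensor_simpleb_ne_zero hF
  let Y := F.objPreimage (simpleb k v 0)
  let e : F.obj (simpleb k a 0 ⊗ Y) ≅ F.obj (simpleb k a 0) ⊗ simpleb k v 0 :=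
    (Functor.Monoidal.μIso F _ _).symm ≪≫ whiskerLeftIso _ (F.objObjPreimageIso _)
  have hY : ¬ IsZero (simpleb k a 0 ⊗ Y) := fun h ↦ hv (e.isZero_iff.1 (F.map_isZero h))
  obtain ⟨u, n, hn⟩ := exists_cohomologyAtb_ne_zero hY
  obtain rfl : u = a := by
    by_contra hu
    exact hn (isZero_cohomologyAtb_simpleb_tensor _ _ _ hu _)
  obtain ⟨r⟩ := nonempty_retract_simpleb hQ u n _
    (fun w hw n ↦ isZero_cohomologyAtb_simpleb_tensor _ _ _ hw n) hn
  let r' : Retract (F.obj (simpleb k u n)) (F.obj (simpleb k u 0) ⊗ simpleb k v 0) :=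
    (r.map F).trans (.ofIso e)
  obtain ⟨m, ⟨e'⟩⟩ := exists_iso_simpleb hQ' v (F.obj (simpleb k u n))
    (fun w hw i ↦ isZero_of_retract (r'.map (cohomologyAtb k i w))
      (isZero_cohomologyAtb_tensor_simpleb _ _ _ hw _))
    (fun h ↦ not_isZero_simpleb u n
      ((IsZero.iff_id_eq_zero _).2 (F.map_injective (h.eq_of_src _ _))))
    ((trivialIdempotents_simpleb u n).map F)
  exact ⟨v, m - n, ⟨F.mapIso (simplebShiftIso u n n 0 (by lia)).symm ≪≫
    (F.commShiftIso n).app _ ≪≫ (shiftFunctor _ n).mapIso e'.symm ≪≫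
      simplebShiftIso v m n (m - n) (by lia)⟩⟩

/-- A monoidal equivalence sends simple representations in degree zero to simple representations in
degree zero. -/
lemma exists_map_simpleb_iso (a : Q) :
    ∃ v : Q', Nonempty (F.obj (simpleb k a 0) ≅ simpleb k v 0) := by
  obtain ⟨v, p, ⟨e⟩⟩ := exists_map_simpleb_iso_shift hQ hQ' F a
  obtain ⟨r⟩ := nonempty_retract_simpleb_tensor_self (k := k) hQ a
  -- The direct factor `r` is carried to the tensor square of `simpleb k v p`, which has no
  -- cohomology in degree `p` unless `p = 0`.
  obtain rfl : p = 0 := by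
    by_contra hp
    have r' : Retract (simpleb k v p) (simpleb k v p ⊗ simpleb k v p) :=
      (Retract.ofIso e.symm).trans ((r.map F).trans (Retract.ofIso
        ((Functor.Monoidal.μIso F _ _).symm ≪≫ (e ⊗ᵢ e))))
    exact not_isZero_cohomologyAtb_simpleb v p (isZero_of_retract (r'.map (cohomologyAtb k p v))
      (isZero_cohomologyAtb_simpleb_tensor_self v p hp))
  exact ⟨v, ⟨e⟩⟩

/-- A monoidal equivalence permutes the simple representations. Surjectivity: if `F Y` is simple at
`v` and `Y ⊗ S a` is nonzero, then `S v ⊗ S (e a)` is nonzero, so that `v = e a`. -/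
lemma exists_equiv_map_simpleb_iso :
    ∃ e : Q ≃ Q', ∀ a, Nonempty (F.obj (simpleb k a 0) ≅ simpleb k (e a) 0) := by
  choose e he using exists_map_simpleb_iso hQ hQ' F
  refine ⟨Equiv.ofBijective e ⟨fun a b hab ↦ ?_, fun v ↦ ?_⟩, he⟩
  · obtain ⟨i⟩ := he a
    obtain ⟨j⟩ := he b
    exact eq_of_iso_simpleb (F.preimageIso (i ≪≫ eqToIso (by rw [hab]) ≪≫ j.symm))
  · let Y := F.objPreimage (simpleb k v 0)
    have hY : ¬ IsZero Y := fun h ↦ not_isZero_simpleb v 0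
      ((F.objObjPreimageIso _).isZero_iff.1 (F.map_isZero h))
    obtain ⟨a, ha⟩ := exists_tensor_simpleb_ne_zero hY
    obtain ⟨i⟩ := he a
    refine ⟨a, ?_⟩
    by_contra hav
    let j : F.obj (Y ⊗ simpleb k a 0) ≅ simpleb k v 0 ⊗ simpleb k (e a) 0 :=
      (Functor.Monoidal.μIso F _ _).symm ≪≫ (F.objObjPreimageIso _ ⊗ᵢ i)
    have hj : ¬ IsZero (simpleb k v 0 ⊗ simpleb k (e a) 0) := fun h ↦
      ha ((IsZero.iff_id_eq_zero _).2 (F.map_injective ((j.isZero_iff.2 h).eq_of_src _ _)))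
    obtain ⟨u, n, hn⟩ := exists_cohomologyAtb_ne_zero hj
    by_cases hu : u = v
    · exact hn (isZero_cohomologyAtb_tensor_simpleb _ _ _ (by rw [hu]; exact Ne.symm hav) _)
    · exact hn (isZero_cohomologyAtb_simpleb_tensor _ _ _ hu _)

end Equivalence

/-! ### Extensions and maps of degree one in the derived category -/

section Extensions

open DerivedCategory Pretriangulated

variable {C : Type*} [Category* C] [Abelian C] [HasDerivedCategory C]

/-- A class of degree one comes from an extension, on whose middle term it vanishes. -/
lemma exists_extension {X Z : C}
    (x : (singleFunctor C 0).obj Z ⟶ ((singleFunctor C 0).obj X)⟦(1 : ℤ)⟧) :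
    ∃ (Y : C) (ι : X ⟶ Y) (π : Y ⟶ Z) (w : ι ≫ π = 0), (ShortComplex.mk ι π w).Exact ∧ Epi π ∧
      (singleFunctor C 0).map π ≫ x = 0 := by
  obtain ⟨M, i, p, hT⟩ := distinguished_cocone_triangle₂ x
  have h₁ : M.IsGE 0 := TStructure.t.isGE₂ _ hT 0
    (inferInstanceAs (((singleFunctor C 0).obj X).IsGE 0))
    (inferInstanceAs (((singleFunctor C 0).obj Z).IsGE 0))
  have h₂ : M.IsLE 0 := TStructure.t.isLE₂ _ hT 0
    (inferInstanceAs (((singleFunctor C 0).obj X).IsLE 0))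
    (inferInstanceAs (((singleFunctor C 0).obj Z).IsLE 0))
  obtain ⟨Y, ⟨e⟩⟩ := exists_iso_singleFunctor_obj_of_isGE_of_isLE M 0
  obtain ⟨ι, hι⟩ := (singleFunctor C 0).map_surjective (i ≫ e.hom)
  obtain ⟨π, hπ⟩ := (singleFunctor C 0).map_surjective (e.inv ≫ p)
  have hT' : Triangle.mk ((singleFunctor C 0).map ι) ((singleFunctor C 0).map π) x ∈
      distTriang _ :=
    isomorphic_distinguished _ hT _ (Triangle.isoMk _ _ (Iso.refl _) e.symm (Iso.refl _)
      (((congrArg (· ≫ e.inv) hι).trans (by simp)).trans (Category.id_comp i).symm)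
      ((Category.comp_id _).trans hπ)
      ((congrArg (x ≫ ·) (CategoryTheory.Functor.map_id _ _)).trans
        ((Category.comp_id x).trans (Category.id_comp x).symm)))
  have w : ι ≫ π = 0 := (singleFunctor C 0).map_injective (by
    rw [Functor.map_comp, Functor.map_zero]
    exact comp_distTriang_mor_zero₁₂ _ hT')
  refine ⟨Y, ι, π, w, ?_, ?_, comp_distTriang_mor_zero₂₃ _ hT'⟩
  · refine ShortComplex.exact_of_iso ?_ (HomologySequence.exact₂ _ hT' 0)
    exact ShortComplex.isoMk ((singleFunctorCompHomologyFunctorIso C 0).app X)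
      ((singleFunctorCompHomologyFunctorIso C 0).app Y)
      ((singleFunctorCompHomologyFunctorIso C 0).app Z)
      ((singleFunctorCompHomologyFunctorIso C 0).hom.naturality ι).symm
      ((singleFunctorCompHomologyFunctorIso C 0).hom.naturality π).symm
  · have : Epi ((singleFunctor C 0 ⋙ homologyFunctor C 0).map π) :=
      (HomologySequence.epi_homologyMap_mor₂_iff _ hT' 0 1 (by lia)).2
        (((singleFunctor C 0).obj X).isZero_of_isLE 0 1 (by lia) |>.eq_of_tgt _ _)
    exact (MorphismProperty.epimorphisms C).arrow_mk_iso_iff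
      (((Functor.mapArrowFunctor _ _).mapIso (singleFunctorCompHomologyFunctorIso C 0)).app
        (Arrow.mk π)) |>.1 this

variable (R : Type*) [Ring R] [Linear R C]

/-- The connecting map of a short exact sequence: composition of its class, a map
`S.X₃ ⟶ S.X₁⟦1⟧`, with the shift of a map `S.X₁ ⟶ X`. -/
def connecting {S : ShortComplex C} (hS : S.ShortExact) (X : C) :
    (S.X₁ ⟶ X) →ₗ[R] ((singleFunctor C 0).obj S.X₃ ⟶ ((singleFunctor C 0).obj X)⟦(1 : ℤ)⟧) :=
  Linear.leftComp R _ hS.singleδ ∘ₗ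
    (shiftFunctor (DerivedCategory C) (1 : ℤ)).mapLinearMap R ∘ₗ
      (singleFunctor C 0).mapLinearMap R

/-- If no nonzero map `S.X₁ ⟶ X` extends to `S.X₂`, and every extension of `S.X₃` by `X`
splits over `S.X₂`, then the connecting map is bijective. -/
lemma connecting_bijective {S : ShortComplex C} (hS : S.ShortExact) (X : C)
    (h₁ : ∀ h : S.X₂ ⟶ X, S.f ≫ h = 0)
    (h₂ : ∀ (Y : C) (ι : X ⟶ Y) (π : Y ⟶ S.X₃) (w : ι ≫ π = 0),
      (ShortComplex.mk ι π w).Exact → Epi π → ∃ s : S.X₂ ⟶ Y, s ≫ π = S.g) :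
    Function.Bijective (connecting R hS X) := by
  have hT := hS.singleTriangle_distinguished
  constructor
  · rw [injective_iff_map_eq_zero]
    intro g hg
    have hg : hS.singleδ ≫ ((singleFunctor C 0).map g)⟦(1 : ℤ)⟧' = 0 := hg
    obtain ⟨h, hh⟩ := Triangle.yoneda_exact₃ _ (rot_of_distTriang _ hT) _ hg
    obtain ⟨h, rfl⟩ := (shiftFunctor (DerivedCategory C) (1 : ℤ)).map_surjective h
    obtain ⟨h, rfl⟩ := (singleFunctor C 0).map_surjective h
    have h' : ((singleFunctor C 0).map g)⟦(1 : ℤ)⟧' =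
        ((singleFunctor C 0).map (S.f ≫ (-h)))⟦(1 : ℤ)⟧' := by
      refine hh.trans ?_
      simp only [Functor.map_comp, Functor.map_neg, Preadditive.comp_neg]
      exact Preadditive.neg_comp _ _
    rw [(singleFunctor C 0).map_injective
      ((shiftFunctor (DerivedCategory C) (1 : ℤ)).map_injective h'), h₁]
  · intro x
    obtain ⟨Y, ι, π, w, hY, hπ, hx⟩ := exists_extension x
    obtain ⟨s, hs⟩ := h₂ Y ι π w hY hπ
    obtain ⟨g, rfl⟩ := Triangle.yoneda_exact₃ _ hT x (by
      change (singleFunctor C 0).map S.g ≫ x = 0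
      rw [← hs, Functor.map_comp, Category.assoc, hx, comp_zero])
    obtain ⟨g, rfl⟩ := (shiftFunctor (DerivedCategory C) (1 : ℤ)).map_surjective g
    obtain ⟨g, rfl⟩ := (singleFunctor C 0).map_surjective g
    exact ⟨g, rfl⟩

end Extensions

/-! ### Maps of degree one between simple representations -/

section UniversalExtension

variable (k : Type u) [Field k] {Q : Type w} [Quiver.{v} Q]

open Classical in
/-- The indicator function of the position of the arrow `α` in an enumeration `σ` of the arrows from
`a` to `b`; it vanishes if `α` does not go from `a` to `b`. -/
def arrowVec {a b : Q} {n : ℕ} (σ : (a ⟶ b) ≃ Fin n) {x y : Q} (α : x ⟶ y) : Fin n → k :=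
  fun i ↦ if (⟨x, y, α⟩ : Σ x y : Q, (x ⟶ y)) = ⟨a, b, σ.symm i⟩ then 1 else 0

variable {k}

lemma arrowVec_self {a b : Q} {n : ℕ} (σ : (a ⟶ b) ≃ Fin n) (α : a ⟶ b) :
    arrowVec k σ α = Pi.single (σ α) 1 := by
  ext i
  rw [arrowVec, Pi.single_apply]
  congr 1
  simp only [Sigma.mk.injEq, heq_eq_eq, true_and, eq_iff_iff]
  rw [eq_comm, Equiv.symm_apply_eq]

lemma arrowVec_eq_zero {a b : Q} {n : ℕ} (σ : (a ⟶ b) ≃ Fin n) {x y : Q} (α : x ⟶ y)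
    (h : y ≠ b) : arrowVec k σ α = 0 := by
  ext i
  refine if_neg (fun h' ↦ h ?_)
  exact congrArg (fun s : Σ x y : Q, (x ⟶ y) ↦ s.2.1) h'

lemma arrowVec_eq_zero_of_source {a b : Q} {n : ℕ} (σ : (a ⟶ b) ≃ Fin n) {x y : Q} (α : x ⟶ y)
    (h : x ≠ a) : arrowVec k σ α = 0 := by
  ext i
  refine if_neg (fun h' ↦ h ?_)
  exact congrArg Sigma.fst h'

lemma simpleAt_map_arrow (v : Q) {x y : Q} (α : x ⟶ y) :
    (simpleAt k v).map ((Paths.of Q).map α) = 0 :=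
  skyscraper_map_arrow _ _ _

variable (k) in
/-- The value at the vertex `w` of `universalExt`. -/
abbrev universalExtAt (a b : Q) (n : ℕ) (w : Q) : FGModuleCat.{u} k :=
  FGModuleCat.of k (gate (w = a) (FGModuleCat.of k k) ×
    gate (w = b) (FGModuleCat.of k (Fin n → k)))

variable (k) in
/-- The action of the arrow `α` on `universalExt`. -/
def universalExtMap {a b : Q} {n : ℕ} (σ : (a ⟶ b) ≃ Fin n) {x y : Q} (α : x ⟶ y) :
    universalExtAt k a b n x ⟶ universalExtAt k a b n y :=
  FGModuleCat.ofHom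
    { toFun p := (0, ⟨(p.1.1 : k) • arrowVec k σ α, fun h ↦ by
        by_contra hy
        refine h ?_
        rw [arrowVec_eq_zero σ α hy, smul_zero]⟩)
      map_add' p q := Prod.ext (add_zero 0).symm (Subtype.ext (add_smul (R := k) _ _ _))
      map_smul' c p := Prod.ext (smul_zero c).symm (Subtype.ext (mul_smul (α := k) _ _ _)) }

variable (k) in
/-- The universal extension of the simple representation at `a` by copies of the simple
representation at `b`, one for each arrow from `a` to `b`. -/
def universalExt {a b : Q} {n : ℕ} (σ : (a ⟶ b) ≃ Fin n) : Rep k Q :=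
  Rep.mk (universalExtAt k a b n) (universalExtMap k σ)

lemma universalExt_map {a b : Q} {n : ℕ} (σ : (a ⟶ b) ≃ Fin n) {x y : Q} (α : x ⟶ y) :
    (universalExt k σ).map ((Paths.of Q).map α) = universalExtMap k σ α :=
  Rep.mk_map _ _ _

variable (k) in
/-- The inclusion of the copies of the simple representation at `b`. -/
def universalExtι {a b : Q} {n : ℕ} (σ : (a ⟶ b) ≃ Fin n) :
    (skyscraper k b).obj (FGModuleCat.of k (Fin n → k)) ⟶ universalExt k σ :=
  Rep.homMk (fun w ↦ (FGModuleCat.ofHom (LinearMap.inr k _ _) : _ ⟶ universalExtAt k a b n w))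
    (fun {x y} α ↦ by
      rw [skyscraper_map_arrow, universalExt_map]
      refine zero_comp.trans (Eq.symm ?_)
      ext v
      exact Prod.ext rfl (Subtype.ext (zero_smul _ _)))

variable (k) in
/-- The projection to the simple representation at `a`. -/
def universalExtπ {a b : Q} {n : ℕ} (σ : (a ⟶ b) ≃ Fin n) :
    universalExt k σ ⟶ simpleAt k a :=
  Rep.homMk (fun w ↦ (FGModuleCat.ofHom (LinearMap.fst k _ _) : universalExtAt k a b n w ⟶ _))
    (fun {x y} α ↦ by
      rw [simpleAt_map_arrow, universalExt_map]
      refine Eq.trans ?_ comp_zero.symm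
      ext v
      rfl)

variable (k) in
/-- The short exact sequence of the universal extension. -/
def universalExtSequence {a b : Q} {n : ℕ} (σ : (a ⟶ b) ≃ Fin n) : ShortComplex (Rep k Q) :=
  ShortComplex.mk (universalExtι k σ) (universalExtπ k σ) (Rep.hom_ext' (fun _ ↦ rfl))

lemma universalExtSequence_shortExact {a b : Q} {n : ℕ} (σ : (a ⟶ b) ≃ Fin n) :
    (universalExtSequence k σ).ShortExact := by
  refine ((jointlyReflects k Q).shortExact_iff _).2 (fun w ↦ ?_)
  refine ShortComplex.Splitting.shortExact
    { r := FGModuleCat.ofHom (LinearMap.snd k _ _)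
      s := FGModuleCat.ofHom (LinearMap.inl k _ _)
      f_r := rfl
      s_g := rfl
      id := ?_ }
  ext p
  refine Prod.ext ?_ ?_
  · exact zero_add p.1
  · exact add_zero p.2

/-- A map from the universal extension to the simple representation at `b` is zero on the
subrepresentation, which is generated by the part at `a`. -/
lemma universalExtι_comp_eq_zero {a b : Q} {n : ℕ} (σ : (a ⟶ b) ≃ Fin n)
    (h : universalExt k σ ⟶ simpleAt k b) : universalExtι k σ ≫ h = 0 := by
  refine Rep.hom_ext' (fun w ↦ ?_)
  by_cases hw : w = b
  · subst hw
    let φ : universalExtAt k a w n w →ₗ[k] gate (w = w) (FGModuleCat.of k k) := (h.app w).hom.hom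
    let ψ : (Fin n → k) →ₗ[k] gate (w = w) (FGModuleCat.of k k) := φ ∘ₗ LinearMap.inr k _ _ ∘ₗ
      LinearMap.codRestrict (gate (w = w) (FGModuleCat.of k (Fin n → k))) LinearMap.id
        (fun _ _ ↦ rfl)
    -- The basis vector of an arrow `α` is the image under `α` of the generator at `a`, and `α` acts
    -- by zero on the target of `h`.
    have hψ : ψ = 0 := by
      refine LinearMap.pi_ext' (fun i ↦ LinearMap.ext_ring ?_)
      obtain ⟨α, rfl⟩ := σ.surjective i
      have h₁ := h.naturality ((Paths.of Q).map α)
      rw [simpleAt_map_arrow, universalExt_map] at h₁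
      have h₂ := LinearMap.congr_fun (ModuleCat.hom_ext_iff.1 (ObjectProperty.hom_ext_iff.1
        (h₁.trans comp_zero))) ((⟨(1 : k), fun _ ↦ rfl⟩, 0) : universalExtAt k a w n a)
      have h₃ : (universalExtMap k σ α).hom.hom
          ((⟨(1 : k), fun _ ↦ rfl⟩, 0) : universalExtAt k a w n a) =
            ((0, ⟨Pi.single (σ α) 1, fun _ ↦ rfl⟩) : universalExtAt k a w n w) := by
        refine Prod.ext rfl (Subtype.ext ?_)
        change (1 : k) • arrowVec k σ α = Pi.single (σ α) (1 : k)
        rw [arrowVec_self, one_smul]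
      exact (congrArg φ h₃.symm).trans h₂
    ext v
    exact LinearMap.congr_fun hψ v.1
  · exact (isZero_ev_skyscraper hw _).eq_of_tgt _ _

open Classical in
/-- The universal extension maps to every extension `M` of the simple representation at `a` by the
one at `b`: the generator goes to a lift `m` of the generator of the quotient, and the basis vector
of an arrow `α` to the image of `m` under `α`. -/
lemma exists_universalExt_lift {a b : Q} {n : ℕ} (σ : (a ⟶ b) ≃ Fin n)
    (M : Rep k Q) (ι : simpleAt k b ⟶ M) (π : M ⟶ simpleAt k a) (w : ι ≫ π = 0)
    (hM : (ShortComplex.mk ι π w).Exact) (hπ : Epi π) :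
    ∃ s : universalExt k σ ⟶ M, s ≫ π = universalExtπ k σ := by
  have ex (x : Q) (z : (ev k x).obj M) (hz : ((ev k x).map π).hom.hom z = 0) :
      ∃ t, ((ev k x).map ι).hom.hom t = z :=
    (ShortComplex.moduleCat_exact_iff _).1
      (((jointlyReflects k Q).exact_iff _).1 hM x |>.map (forget₂ _ (ModuleCat.{u} k))) z hz
  have hzero (x : Q) (hx : x ≠ b) (z : (ev k x).obj M) (hz : ((ev k x).map π).hom.hom z = 0) :
      z = 0 := by
    obtain ⟨t, rfl⟩ := ex x z hz
    have : (ev k x).map ι = 0 := (isZero_ev_skyscraper hx _).eq_of_src _ _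
    rw [this]
    rfl
  have harrow {x y : Q} (α : x ⟶ y) (z : (ev k x).obj M)
      (hz : ((ev k x).map π).hom.hom z = 0) : (M.map ((Paths.of Q).map α)).hom.hom z = 0 := by
    obtain ⟨t, rfl⟩ := ex x z hz
    have h := ι.naturality ((Paths.of Q).map α)
    rw [simpleAt_map_arrow, zero_comp] at h
    exact (LinearMap.congr_fun (ModuleCat.hom_ext_iff.1 (ObjectProperty.hom_ext_iff.1 h)) t).symm
  have harrow' {x y : Q} (α : x ⟶ y) (z : (ev k x).obj M) :
      ((ev k y).map π).hom.hom ((M.map ((Paths.of Q).map α)).hom.hom z) = 0 := by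
    have h := π.naturality ((Paths.of Q).map α)
    rw [simpleAt_map_arrow, comp_zero] at h
    exact LinearMap.congr_fun (ModuleCat.hom_ext_iff.1 (ObjectProperty.hom_ext_iff.1 h)) z
  obtain ⟨m, hm⟩ : ∃ m : (ev k a).obj M, ((ev k a).map π).hom.hom m =
      (⟨(1 : k), fun _ ↦ rfl⟩ : gate (a = a) (FGModuleCat.of k k)) :=
    (ModuleCat.epi_iff_surjective ((forget₂ _ (ModuleCat.{u} k)).map ((ev k a).map π))).1
      inferInstance _
  -- The images of `m` and of the basis vectors are written as dependent functions on all vertices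
  -- that vanish away from `a`, respectively `b`.
  let t (i : Fin n) : ∀ x, (ev k x).obj M :=
    Pi.single b ((M.map ((Paths.of Q).map (σ.symm i))).hom.hom m)
  let f (x : Q) : universalExtAt k a b n x →ₗ[k] (ev k x).obj M :=
    (LinearMap.coprod (LinearMap.toSpanSingleton k ((ev k x).obj M)
      ((Pi.single a m : ∀ x, (ev k x).obj M) x)) (Fintype.linearCombination k (fun i ↦ t i x))) ∘ₗ
        LinearMap.prodMap (gate (x = a) (FGModuleCat.of k k)).subtype
          (gate (x = b) (FGModuleCat.of k (Fin n → k))).subtype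
  have hf (x : Q) (p : universalExtAt k a b n x) : f x p =
      (p.1.1 : k) • (Pi.single a m : ∀ x, (ev k x).obj M) x +
        ∑ i, (p.2.1 : Fin n → k) i • t i x := rfl
  have ht (x : Q) (i : Fin n) : ((ev k x).map π).hom.hom (t i x) = 0 := by
    by_cases hx : x = b
    · subst hx
      simpa [t] using harrow' _ _
    · simp [t, Pi.single_eq_of_ne hx]
  have hα {x y : Q} (α : x ⟶ y) : ∑ i, arrowVec k σ α i • t i y =
      (M.map ((Paths.of Q).map α)).hom.hom ((Pi.single a m : ∀ x, (ev k x).obj M) x) := by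
    by_cases hx : x = a
    · subst hx
      rw [Pi.single_eq_same]
      by_cases hy : y = b
      · subst hy
        rw [arrowVec_self, Finset.sum_eq_single (σ α) (fun i _ hi ↦ by
          rw [Pi.single_eq_of_ne hi, zero_smul]) (by simp), Pi.single_eq_same, one_smul]
        simp [t]
      · rw [arrowVec_eq_zero σ α hy, hzero y hy _ (harrow' α m)]
        simp
    · rw [arrowVec_eq_zero_of_source σ α hx, Pi.single_eq_of_ne hx, map_zero]
      simp
  have h₁ {x y : Q} (α : x ⟶ y) (p : universalExtAt k a b n x) :
      f y ((universalExtMap k σ α).hom.hom p) =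
        (M.map ((Paths.of Q).map α)).hom.hom (f x p) := by
    have h₀ : (M.map ((Paths.of Q).map α)).hom.hom (f x p) =
        (p.1.1 : k) • ∑ i, arrowVec k σ α i • t i y := by
      rw [hf, map_add, map_sum]
      simp_rw [map_smul]
      rw [Finset.sum_eq_zero (fun i _ ↦ by rw [harrow α _ (ht x i), smul_zero]), add_zero, hα]
    rw [h₀, hf]
    change (0 : k) • _ + ∑ i, (((p.1.1 : k) • arrowVec k σ α : Fin n → k) i) • t i y = _
    rw [zero_smul, zero_add]
    simp_rw [Pi.smul_apply, smul_assoc]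
    rw [← Finset.smul_sum]
  have h₂ (x : Q) (p : universalExtAt k a b n x) : ((ev k x).map π).hom.hom (f x p) = p.1 := by
    rw [hf, map_add, map_sum]
    simp_rw [map_smul]
    rw [Finset.sum_eq_zero (fun i _ ↦ by rw [ht x i, smul_zero]), add_zero]
    by_cases hx : x = a
    · subst hx
      rw [Pi.single_eq_same, hm]
      exact Subtype.ext (mul_one (p.1.1 : k))
    · rw [Pi.single_eq_of_ne hx, map_zero, smul_zero]
      exact Subtype.ext (eq_zero_of_mem_gate p.1.2 hx).symm
  refine ⟨Rep.homMk (fun x ↦ ObjectProperty.homMk (ModuleCat.ofHom (f x))) (fun {x y} α ↦ ?_),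
    Rep.hom_ext' (fun x ↦ ?_)⟩
  · rw [universalExt_map]
    ext p
    exact h₁ α p
  · ext p
    exact h₂ x p

variable (k) in
instance (v : Q) : (skyscraper k v).Linear k where
  map_smul _ _ := Rep.hom_ext' (fun w ↦ gated_hom_ext (P := w = v) rfl)

variable (k) in
instance (v : Q) : (skyscraper k v).Faithful where
  map_injective {V W f g} h := by
    let e := evSkyscraperIso (k := k) v
    have h' := congrArg (fun φ ↦ e.inv.app V ≫ (ev k v).map φ ≫ e.hom.app W) h
    refine Eq.trans ?_ (h'.trans ?_)
    · exact (NatIso.naturality_1 e f).symm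
    · exact NatIso.naturality_1 e g

variable (k) in
instance (v : Q) : (skyscraper k v).Full where
  map_surjective {V W} f := by
    have := isIso_gatedι (P := v = v) rfl V
    refine ⟨inv (gatedι (v = v) V) ≫ f.app v ≫ gatedι (v = v) W, Rep.hom_ext' (fun w ↦ ?_)⟩
    by_cases hw : w = v
    · subst hw
      refine gated_hom_ext (P := w = w) (V := W) ?_
      change gatedMap (P := w = w) _ id ≫ gatedι _ _ = f.app w ≫ gatedι _ _
      rw [gatedMap_ι, IsIso.hom_inv_id_assoc]
      rfl
    · exact (isZero_ev_skyscraper hw _).eq_of_tgt _ _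

/-- The maps of degree one between simple representations count the arrows. -/
lemma finrank_hom_simpleb_shift {a b : Q} {n : ℕ} (σ : (a ⟶ b) ≃ Fin n) :
    Module.finrank k (simpleb k a 0 ⟶ (simpleb k b 0)⟦(1 : ℤ)⟧) = n := by
  have hS := universalExtSequence_shortExact (k := k) σ
  let V : FGModuleCat.{u} k := FGModuleCat.of k (Fin n → k)
  let e₁ : (V ⟶ FGModuleCat.of k k) ≃ₗ[k]
      ((skyscraper k b).obj V ⟶ (skyscraper k b).obj (FGModuleCat.of k k)) :=
    LinearEquiv.ofBijective ((skyscraper k b).mapLinearMap k)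
      ⟨(skyscraper k b).map_injective, (skyscraper k b).map_surjective⟩
  let e₂ := LinearEquiv.ofBijective (connecting k hS (simpleAt k b))
    (connecting_bijective k hS _ (universalExtι_comp_eq_zero σ)
      (fun M ι π w h h' ↦ exists_universalExt_lift σ M ι π w h h'))
  let e₃ : (simpleb k a 0 ⟶ (simpleb k b 0)⟦(1 : ℤ)⟧) ≃ₗ[k] (_ ⟶ _) :=
    LinearEquiv.ofBijective (DerivedCategory.Bounded.ι.mapLinearMap k)
      ⟨DerivedCategory.Bounded.ι.map_injective, DerivedCategory.Bounded.ι.map_surjective⟩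
  let e₄ := Linear.homCongr k (simplebIso k a 0)
    ((DerivedCategory.Bounded.ι.commShiftIso (1 : ℤ)).app (simpleb k b 0) ≪≫
      (shiftFunctor (DerivedCategory (Rep k Q)) (1 : ℤ)).mapIso (simplebIso k b 0))
  let e₅ : (V ⟶ FGModuleCat.of k k) ≃ₗ[k] ((Fin n → k) →ₗ[k] k) :=
    InducedCategory.homLinearEquiv.trans ModuleCat.homLinearEquiv
  have e := e₅.symm.trans (e₁.trans (e₂.trans (e₄.symm.trans e₃.symm)))
  rw [← e.finrank_eq, Module.finrank_linearMap, Module.finrank_fin_fun, Module.finrank_self,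
    mul_one]

end UniversalExtension

end QuiverDb

end

theorem corollary0p6 (k : Type*) [Field k] [IsAlgClosed k]
    (Q : Type*) [Quiver Q] (Q' : Type*) [Quiver Q']
    (hQ : QuiverDb.IsFiniteAcyclic Q) (hQ' : QuiverDb.IsFiniteAcyclic Q')
    (F : QuiverDb.Db k Q ⥤ QuiverDb.Db k Q') [F.IsEquivalence]
    [F.Additive] [F.Linear k] [F.Monoidal] [F.CommShift ℤ] [F.IsTriangulated] :
    Nonempty (QuiverDb.QuiverIso Q Q') := by
  obtain ⟨e, he⟩ := QuiverDb.exists_equiv_map_simpleb_iso hQ hQ' F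
  have key (a b : Q) : Nonempty ((a ⟶ b) ≃ (e a ⟶ e b)) := by
    have := hQ.finite_arrows a b
    have := hQ'.finite_arrows (e a) (e b)
    obtain ⟨i⟩ := he a
    obtain ⟨j⟩ := he b
    let l₁ : (QuiverDb.simpleb k a 0 ⟶ (QuiverDb.simpleb k b 0)⟦(1 : ℤ)⟧) ≃ₗ[k] (_ ⟶ _) :=
      LinearEquiv.ofBijective (F.mapLinearMap k) ⟨F.map_injective, F.map_surjective⟩
    let l₂ := Linear.homCongr k i
      ((F.commShiftIso (1 : ℤ)).app (QuiverDb.simpleb k b 0) ≪≫ (shiftFunctor _ (1 : ℤ)).mapIso j)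
    have h := (l₁.trans l₂).finrank_eq
    rw [QuiverDb.finrank_hom_simpleb_shift (Finite.equivFin _),
      QuiverDb.finrank_hom_simpleb_shift (Finite.equivFin _)] at h
    exact Finite.card_eq.1 h
  exact ⟨⟨e, fun a b ↦ (key a b).some⟩⟩
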